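/- **Theorem (soundness of simple-edge elimination).** The atomic-flow reduction $\to_{\mathsf{se}}$ is sound: if $B\to_{\mathsf{se}}C$ and $\Phi$ is an $\mathsf{SKS}$ derivation whose atomic flow is $B$, then there is an $\mathsf{SKS}$ derivation $\Psi$ with atomic flow $C$ and with the same premiss and the same conclusion as $\Phi$. The notions are as follows. *Derivations.* Fix a set of atoms with an involution $a\mapsto\bar a$ without fixed points. Formulae are freely built from the units $\mathsf f,\mathsf t$ and the atoms by disjunction $[\alpha\vee\beta]$ and conjunction $(\alpha\wedge\beta)$. A derivation from a premiss to a conclusion is a finite (possibly empty) chain of steps $\xi\{\gamma\}\to\xi\{\delta\}$, where $\xi\{\ \}$ is a context (a formula with a hole) and $\gamma\to\delta$ is an instance of a rule of $\mathsf{SKS}$: - structural rules: interaction $\mathsf t\to[a\vee\bar a]$, cointeraction $(a\wedge\bar a)\to\mathsf f$, weakening $\mathsf f\to a$, coweakening $a\to\mathsf t$, contraction $[a\vee a]\to a$, cocontraction $a\to(a\wedge a)$, for atoms $a$; - switch $(\alpha\wedge[\beta\vee\gamma])\to[(\alpha\wedge\beta)\vee\gamma]$ and medial $[(\alpha\wedge\beta)\vee(\gamma\wedge\delta)]\to([\alpha\vee\gamma]\wedge[\beta\vee\delta])$;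 - the rule $=$, which replaces one side by the other, in either direction, in one of the equations stating commutativity and associativity of $\vee$ and of $\wedge$, $[\alpha\vee\mathsf f]=\alpha$, $(\alpha\wedge\mathsf t)=\alpha$, $[\mathsf t\vee\mathsf t]=\mathsf t$, $(\mathsf f\wedge\mathsf f)=\mathsf f$. *Flows.* An atomic flow is a tuple $(V,E,\eta,\mathit{up},\mathit{lo})$ with finite sets $V$ of vertices and $E$ of edges, a map $\eta$ that labels each vertex with one of the six structural rules, and maps $\mathit{up}\colon E\to V\cup\{\top\}$, $\mathit{lo}\colon E\to V\cup\{\bot\}$, where $\top,\bot\notin V$. The lower edges of $\nu$ are the $\epsilon$ with $\mathit{up}(\epsilon)=\nu$, its upper edges are the $\epsilon$ with $\mathit{lo}(\epsilon)=\nu$. It is required that (1) the numbers of (lower, upper) edges of a vertex are $(2,0)$ for an interaction, $(0,2)$ for a cointeraction, $(1,0)$ for a weakening, $(0,1)$ for a coweakening, $(1,2)$ for a contraction, $(2,1)$ for a cocontraction; (2) there is no directed cycle, that is, no sequence $\epsilon_1,\dots,\epsilon_h$ ($h\ge1$) of edges in which each edge ends, in the cyclic order, at the vertex at which the next one starts;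 (3) there is a polarity assignment, that is, a map $\pi\colon E\to\{-,+\}$ that is constant on the edges of each contraction and of each cocontraction and takes both values on the edges of each interaction and of each cointeraction. The lower edges of $\top$ and the upper edges of $\bot$ are called the upper and the lower edges of the flow. Flows are considered up to isomorphism. *The flow of a derivation.* A derivation $\Phi$ has atomic flow $A$ if the atom occurrences in the formulae of $\Phi$ can be mapped to edges of $A$ such that: switch, medial and $=$ steps, and the contexts of structural steps, preserve the edges of the atom occurrences; the structural steps correspond one-to-one to the vertices of $A$, the label of a vertex is the rule of its step, and the atom occurrences in the conclusion (premiss) of the rule instance are mapped one-to-one to the lower (upper) edges of that vertex; the atom occurrences in the premiss of $\Phi$ are mapped one-to-one to the upper edges of $A$, those in the conclusion of $\Phi$ one-to-one to the lower edges of $A$. *Reductions and soundness.* A reduction is a binary relation $R$ on atomic flows such that $C\mathrel RD$ implies that the upper edges of $C$ and of $D$, and the lower edges of $C$ and of $D$, are in bijection. It is sound if, whenever $A\mathrel RB$, for every derivation $\Phi$ with flow $A$ there is a derivation $\Psi$ with flow $B$ and with the same premiss and conclusion as $\Phi$. *The reduction $\to_{\mathsf{se}}$.* Let $A$ be an atomic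 flow with a distinguished upper edge $\mathbf 2$ and a distinguished lower edge $\mathbf 3$ (possibly the same edge); let $\epsilon_1,\dots,\epsilon_h$ be its other upper edges and $\epsilon'_1,\dots,\epsilon'_k$ its other lower edges ($h,k\ge0$). Let $B$ be obtained from $A$ by adding an interaction, a cointeraction and a new edge $\mathbf 1$ from this interaction to this cointeraction (a *simple edge*), and by letting $\mathbf 2$ start at the interaction and $\mathbf 3$ end at the cointeraction; assume that $B$ is an atomic flow. Let $C$ be obtained from two disjoint copies $\hat A$ and $\tilde A$ of $A$ as follows: $\hat{\mathbf 2}$ and $\tilde{\mathbf 3}$ are identified, forming one edge that starts where $\tilde{\mathbf 3}$ starts and ends where $\hat{\mathbf 2}$ ends; $\tilde{\mathbf 2}$ starts at a new weakening; $\hat{\mathbf 3}$ ends at a new coweakening; for each $i$, $\hat\epsilon_i$ and $\tilde\epsilon_i$ start at a new cocontraction, whose upper edge is an upper edge of $C$; for each $j$, $\hat\epsilon'_j$ and $\tilde\epsilon'_j$ end at a new contraction, whose lower edge is a lower edge of $C$. Then $B\to_{\mathsf{se}}C$, and (up to isomorphism of $B$ and of $C$) these are all the instances of $\to_{\mathsf{se}}$.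 -/

import Mathlib

namespace AtomicFlows

universe u v w

/-! ### Formulae and derivations -/

/-- A set of atoms, with an involution `dual` that has no fixed point. -/
class DualAtoms (X : Type u) where
  dual : X → X
  dual_dual : ∀ a, dual (dual a) = a
  dual_ne : ∀ a, dual a ≠ a

/-- Formulae, freely built from the units `ff` (false) and `tt` (true) and from leaves in `L` by
disjunction and conjunction. The leaves are atoms (`L = X`) or, in `LabelledRule` below, atoms
decorated with an edge of a flow (`L = X × E`); a leaf of a formula is an atom occurrence. -/
inductive Formula (L : Type u) : Type u
  | ff : Formula L
  | tt : Formula L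
  | leaf (x : L) : Formula L
  | or (α β : Formula L) : Formula L
  | and (α β : Formula L) : Formula L

namespace Formula

/-- Rename the leaves of a formula. -/
def map {L : Type u} {M : Type v} (f : L → M) : Formula L → Formula M
  | ff => ff
  | tt => tt
  | leaf x => leaf (f x)
  | or α β => or (α.map f) (β.map f)
  | and α β => and (α.map f) (β.map f)

/-- The leaves of a formula, from left to right. -/
def leaves {L : Type u} : Formula L → List L
  | ff => []
  | tt => []
  | leaf x => [x]
  | or α β => α.leaves ++ β.leaves
  | and α β => α.leaves ++ β.leaves

end Formula

open Formula in
/-- The equations `γ = δ` between formulae. -/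
inductive Equation {L : Type u} : Formula L → Formula L → Type u
  | orComm (α β : Formula L) : Equation (or α β) (or β α)
  | andComm (α β : Formula L) : Equation (and α β) (and β α)
  | orAssoc (α β γ : Formula L) : Equation (or (or α β) γ) (or α (or β γ))
  | andAssoc (α β γ : Formula L) : Equation (and (and α β) γ) (and α (and β γ))
  | orFalse (α : Formula L) : Equation (or α ff) α
  | andTrue (α : Formula L) : Equation (and α tt) α
  | trueTrue : Equation (or tt tt) tt
  | falseFalse : Equation (and ff ff) ff

open Formula in
/-- Instances (premiss, conclusion) of the linear rules of `SKS`: switch, medial, and the rule `=`,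
which replaces one side of an equation by the other. -/
inductive LinearRule {L : Type u} : Formula L → Formula L → Type u
  | switch (α β γ : Formula L) : LinearRule (and α (or β γ)) (or (and α β) γ)
  | medial (α β γ δ : Formula L) :
      LinearRule (or (and α β) (and γ δ)) (and (or α γ) (or β δ))
  | eqLR {γ δ : Formula L} (e : Equation γ δ) : LinearRule γ δ
  | eqRL {γ δ : Formula L} (e : Equation γ δ) : LinearRule δ γ

open Formula DualAtoms in
/-- Instances (premiss, conclusion) of the six structural rules of `SKS`. -/
inductive StructuralRule {X : Type u} [DualAtoms X] : Formula X → Formula X → Type u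
  | interaction (a : X) : StructuralRule tt (or (leaf a) (leaf (dual a)))
  | cointeraction (a : X) : StructuralRule (and (leaf a) (leaf (dual a))) ff
  | weakening (a : X) : StructuralRule ff (leaf a)
  | coweakening (a : X) : StructuralRule (leaf a) tt
  | contraction (a : X) : StructuralRule (or (leaf a) (leaf a)) (leaf a)
  | cocontraction (a : X) : StructuralRule (leaf a) (and (leaf a) (leaf a))

open Formula in
/-- Inference steps: a linear rule, or a rule of the family `S`, applied at any depth inside a
formula. The constructors `orLeft`, …, `andRight` spell out the context of the rule instance. -/
inductive Step {L : Type u} (S : Formula L → Formula L → Type v) :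
    Formula L → Formula L → Type (max u v)
  | linear {α β : Formula L} (r : LinearRule α β) : Step S α β
  | structural {α β : Formula L} (r : S α β) : Step S α β
  | orLeft {α β : Formula L} (s : Step S α β) (γ : Formula L) : Step S (or α γ) (or β γ)
  | orRight (γ : Formula L) {α β : Formula L} (s : Step S α β) : Step S (or γ α) (or γ β)
  | andLeft {α β : Formula L} (s : Step S α β) (γ : Formula L) : Step S (and α γ) (and β γ)
  | andRight (γ : Formula L) {α β : Formula L} (s : Step S α β) : Step S (and γ α) (and γ β)

/-- Finite, possibly empty, chains of inference steps, from the top formula to the bottom one. -/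
inductive Chain {L : Type u} (S : Formula L → Formula L → Type v) :
    Formula L → Formula L → Type (max u v)
  | nil (α : Formula L) : Chain S α α
  | cons {α β γ : Formula L} (s : Step S α β) (c : Chain S β γ) : Chain S α γ

/-- `SKS` derivations over the atoms `X`. -/
structure Derivation (X : Type u) [DualAtoms X] where
  premiss : Formula X
  conclusion : Formula X
  chain : Chain (StructuralRule (X := X)) premiss conclusion

/-! ### Atomic flows -/

/-- The labels of the vertices of a flow. -/
inductive VertexLabel
  | interaction
  | cointeraction
  | weakening
  | coweakening
  | contraction
  | cocontraction

namespace VertexLabel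

/-- The number of lower edges of a vertex with the given label. -/
def numLower : VertexLabel → ℕ
  | interaction => 2
  | cointeraction => 0
  | weakening => 1
  | coweakening => 0
  | contraction => 1
  | cocontraction => 2

/-- The number of upper edges of a vertex with the given label. -/
def numUpper : VertexLabel → ℕ
  | interaction => 0
  | cointeraction => 2
  | weakening => 0
  | coweakening => 1
  | contraction => 2
  | cocontraction => 1

end VertexLabel

/-- The data `(V, E, η, up, lo)` of a flow. The value `none` of `up` stands for the special vertex
`⊤`, and the value `none` of `lo` stands for the special vertex `⊥`. -/
structure FlowGraph where
  V : Type w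
  E : Type w
  η : V → VertexLabel
  up : E → Option V
  lo : E → Option V

namespace FlowGraph

/-- The lower edges of a vertex; `F.lowerEdges none` is the set of lower edges of `⊤`, that is, the
set of upper edges of the flow. -/
def lowerEdges (F : FlowGraph.{w}) (ν : Option F.V) : Set F.E := {e | F.up e = ν}

/-- The upper edges of a vertex; `F.upperEdges none` is the set of upper edges of `⊥`, that is, the
set of lower edges of the flow. -/
def upperEdges (F : FlowGraph.{w}) (ν : Option F.V) : Set F.E := {e | F.lo e = ν}

/-- All the edges of a vertex (different from `⊤` and `⊥`). -/
def edgesOf (F : FlowGraph.{w}) (ν : F.V) : Set F.E :=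
  F.lowerEdges (some ν) ∪ F.upperEdges (some ν)

/-- The edge `e'` starts at the vertex (different from `⊤` and `⊥`) at which `e` ends. -/
def Follows (F : FlowGraph.{w}) (e e' : F.E) : Prop :=
  ∃ ν : F.V, F.lo e = some ν ∧ F.up e' = some ν

/-- Polarity assignments; `false` and `true` are the negative and the positive polarity. -/
def IsPolarity (F : FlowGraph.{w}) (π : F.E → Bool) : Prop :=
  ∀ ν : F.V,
    ((F.η ν = .contraction ∨ F.η ν = .cocontraction) →
      π '' F.edgesOf ν = {false} ∨ π '' F.edgesOf ν = {true}) ∧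
    ((F.η ν = .interaction ∨ F.η ν = .cointeraction) →
      π '' F.edgesOf ν = {false, true})

/-- The conditions under which `(V, E, η, up, lo)` is an atomic flow. -/
structure IsFlow (F : FlowGraph.{w}) : Prop where
  finite_V : Finite F.V
  finite_E : Finite F.E
  card_lower : ∀ ν : F.V, (F.lowerEdges (some ν)).ncard = (F.η ν).numLower
  card_upper : ∀ ν : F.V, (F.upperEdges (some ν)).ncard = (F.η ν).numUpper
  acyclic : ∀ e : F.E, ¬ Relation.TransGen F.Follows e e
  polarity : ∃ π : F.E → Bool, F.IsPolarity π

/-- Isomorphisms of flows. -/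
structure Iso (F G : FlowGraph.{w}) where
  onV : F.V ≃ G.V
  onE : F.E ≃ G.E
  map_η : ∀ ν, G.η (onV ν) = F.η ν
  map_up : ∀ e, G.up (onE e) = (F.up e).map onV
  map_lo : ∀ e, G.lo (onE e) = (F.lo e).map onV

end FlowGraph

/-- Atomic flows. -/
structure AtomicFlow extends FlowGraph.{w} where
  isFlow : toFlowGraph.IsFlow

/-! ### The flow associated with a derivation -/

open Formula DualAtoms in
/-- Instances of the six structural rules in which the atom occurrences are decorated with edges of
a flow `F`, such that the edges are the upper and lower edges of a vertex of `F` with the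
corresponding label. -/
inductive LabelledRule {X : Type u} [DualAtoms X] (F : FlowGraph.{w}) :
    Formula (X × F.E) → Formula (X × F.E) → Type (max u w)
  | interaction (ν : F.V) (a : X) (e₁ e₂ : F.E) (hν : F.η ν = .interaction) (hne : e₁ ≠ e₂)
      (h₁ : F.up e₁ = some ν) (h₂ : F.up e₂ = some ν) :
      LabelledRule F tt (or (leaf (a, e₁)) (leaf (dual a, e₂)))
  | cointeraction (ν : F.V) (a : X) (e₁ e₂ : F.E) (hν : F.η ν = .cointeraction) (hne : e₁ ≠ e₂)
      (h₁ : F.lo e₁ = some ν) (h₂ : F.lo e₂ = some ν) :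
      LabelledRule F (and (leaf (a, e₁)) (leaf (dual a, e₂))) ff
  | weakening (ν : F.V) (a : X) (e₁ : F.E) (hν : F.η ν = .weakening) (h₁ : F.up e₁ = some ν) :
      LabelledRule F ff (leaf (a, e₁))
  | coweakening (ν : F.V) (a : X) (e₁ : F.E) (hν : F.η ν = .coweakening)
      (h₁ : F.lo e₁ = some ν) :
      LabelledRule F (leaf (a, e₁)) tt
  | contraction (ν : F.V) (a : X) (e₁ e₂ e₃ : F.E) (hν : F.η ν = .contraction) (hne : e₁ ≠ e₂)
      (h₁ : F.lo e₁ = some ν) (h₂ : F.lo e₂ = some ν) (h₃ : F.up e₃ = some ν) :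
      LabelledRule F (or (leaf (a, e₁)) (leaf (a, e₂))) (leaf (a, e₃))
  | cocontraction (ν : F.V) (a : X) (e₁ e₂ e₃ : F.E) (hν : F.η ν = .cocontraction)
      (hne : e₂ ≠ e₃) (h₁ : F.lo e₁ = some ν) (h₂ : F.up e₂ = some ν) (h₃ : F.up e₃ = some ν) :
      LabelledRule F (leaf (a, e₁)) (and (leaf (a, e₂)) (leaf (a, e₃)))

/-- Rename the leaves in an equation. -/
def Equation.map {L : Type u} {M : Type v} (f : L → M) {α β : Formula L} :
    Equation α β → Equation (α.map f) (β.map f)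
  | orComm α β => orComm (α.map f) (β.map f)
  | andComm α β => andComm (α.map f) (β.map f)
  | orAssoc α β γ => orAssoc (α.map f) (β.map f) (γ.map f)
  | andAssoc α β γ => andAssoc (α.map f) (β.map f) (γ.map f)
  | orFalse α => orFalse (α.map f)
  | andTrue α => andTrue (α.map f)
  | trueTrue => trueTrue
  | falseFalse => falseFalse

/-- Rename the leaves in an instance of a linear rule. -/
def LinearRule.map {L : Type u} {M : Type v} (f : L → M) {α β : Formula L} :
    LinearRule α β → LinearRule (α.map f) (β.map f)
  | switch α β γ => switch (α.map f) (β.map f) (γ.map f)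
  | medial α β γ δ => medial (α.map f) (β.map f) (γ.map f) (δ.map f)
  | eqLR e => eqLR (e.map f)
  | eqRL e => eqRL (e.map f)

section Labelled

variable {X : Type u} [DualAtoms X] {F : FlowGraph.{w}}

/-- Forget the edges that decorate the atom occurrences of a formula. -/
abbrev Formula.erase {X : Type u} {E : Type w} (α : Formula (X × E)) : Formula X :=
  α.map Prod.fst

/-- Forget the edges. -/
def LabelledRule.erase {α β : Formula (X × F.E)} :
    LabelledRule F α β → StructuralRule α.erase β.erase
  | interaction _ a _ _ _ _ _ _ => .interaction a
  | cointeraction _ a _ _ _ _ _ _ => .cointeraction a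
  | weakening _ a _ _ _ => .weakening a
  | coweakening _ a _ _ _ => .coweakening a
  | contraction _ a _ _ _ _ _ _ _ _ => .contraction a
  | cocontraction _ a _ _ _ _ _ _ _ _ => .cocontraction a

/-- The vertex to which a decorated instance of a structural rule is mapped. -/
def LabelledRule.vertex {α β : Formula (X × F.E)} : LabelledRule F α β → F.V
  | interaction ν _ _ _ _ _ _ _ => ν
  | cointeraction ν _ _ _ _ _ _ _ => ν
  | weakening ν _ _ _ _ => ν
  | coweakening ν _ _ _ _ => ν
  | contraction ν _ _ _ _ _ _ _ _ _ => ν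
  | cocontraction ν _ _ _ _ _ _ _ _ _ => ν

/-- Forget the edges. -/
def Step.erase {α β : Formula (X × F.E)} :
    Step (LabelledRule F) α β → Step (StructuralRule (X := X)) α.erase β.erase
  | linear r => linear (r.map Prod.fst)
  | structural r => structural r.erase
  | orLeft s γ => orLeft s.erase γ.erase
  | orRight γ s => orRight γ.erase s.erase
  | andLeft s γ => andLeft s.erase γ.erase
  | andRight γ s => andRight γ.erase s.erase

/-- The vertex to which a decorated inference step is mapped, if it is structural. -/
def Step.vertices {α β : Formula (X × F.E)} : Step (LabelledRule F) α β → List F.V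
  | linear _ => []
  | structural r => [r.vertex]
  | orLeft s _ => s.vertices
  | orRight _ s => s.vertices
  | andLeft s _ => s.vertices
  | andRight _ s => s.vertices

/-- Forget the edges. -/
def Chain.erase {α β : Formula (X × F.E)} :
    Chain (LabelledRule F) α β → Chain (StructuralRule (X := X)) α.erase β.erase
  | nil α => nil α.erase
  | cons s c => cons s.erase c.erase

/-- The vertices to which the structural steps of a decorated chain are mapped. -/
def Chain.vertices {α β : Formula (X × F.E)} : Chain (LabelledRule F) α β → List F.V
  | nil _ => []
  | cons s c => s.vertices ++ c.vertices

/-- The edges that occur in a decorated formula. -/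
def Formula.edges {X : Type u} {E : Type w} (α : Formula (X × E)) : List E :=
  α.leaves.map Prod.snd

end Labelled

/-- The flow `F` is associated with the derivation `Φ`: the atom occurrences of `Φ` can be decorated
with edges of `F` such that
* in a linear step, and in the context of a structural step, every atom occurrence keeps its edge;
* the atom occurrences of an instance of a structural rule are decorated with the edges of a vertex
  of `F` that has the label of the rule, and this sets up a bijection between the structural steps
  of `Φ` and the vertices of `F`;
* the atom occurrences of the premiss correspond one-to-one to the lower edges of `⊤`, those of the
  conclusion to the upper edges of `⊥`.

As every edge comes from `⊤` or from exactly one structural step, two atom occurrences then have the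
same edge exactly if one is traced to the other through the derivation, and every edge of `F`
decorates an atom occurrence. -/
def Derivation.HasFlow {X : Type u} [DualAtoms X] (Φ : Derivation X) (F : AtomicFlow.{w}) : Prop :=
  ∃ (α β : Formula (X × F.E)) (c : Chain (LabelledRule F.toFlowGraph) α β),
    (⟨α.erase, β.erase, c.erase⟩ : Derivation X) = Φ ∧
    (c.vertices.Nodup ∧ ∀ ν : F.V, ν ∈ c.vertices) ∧
    (α.edges.Nodup ∧ ∀ e : F.E, e ∈ α.edges ↔ e ∈ F.lowerEdges none) ∧
    (β.edges.Nodup ∧ ∀ e : F.E, e ∈ β.edges ↔ e ∈ F.upperEdges none)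

/-! ### Reductions and soundness -/

/-- Atomic-flow reductions: binary relations on atomic flows such that related flows have upper
edges in one-to-one correspondence and lower edges in one-to-one correspondence. -/
structure Reduction where
  rel : AtomicFlow.{w} → AtomicFlow.{w} → Prop
  upper : ∀ C D, rel C D → Nonempty (C.lowerEdges none ≃ D.lowerEdges none)
  lower : ∀ C D, rel C D → Nonempty (C.upperEdges none ≃ D.upperEdges none)

/-- A reduction is sound (with respect to derivations over the atoms `X`). -/
def Reduction.IsSound (X : Type u) [DualAtoms X] (R : Reduction.{w}) : Prop :=
  ∀ A B : AtomicFlow.{w}, R.rel A B → ∀ Φ : Derivation X, Φ.HasFlow A →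
    ∃ Ψ : Derivation X, Ψ.HasFlow B ∧
      Ψ.premiss = Φ.premiss ∧ Ψ.conclusion = Φ.conclusion

/-! ### Elimination of a simple edge -/

/-- A simple edge: a single edge from an interaction to a cointeraction. -/
def FlowGraph.IsSimpleEdge (F : FlowGraph.{w}) (e : F.E) : Prop :=
  ∃ ν ν' : F.V, F.up e = some ν ∧ F.lo e = some ν' ∧
    F.η ν = .interaction ∧ F.η ν' = .cointeraction

/-- A flow `A` with a distinguished upper edge `e₂` and a distinguished lower edge `e₃`
(`e₂ = e₃` is possible). -/
structure SEData where
  A : AtomicFlow.{w}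
  e₂ : A.E
  e₃ : A.E
  up_e₂ : A.up e₂ = none
  lo_e₃ : A.lo e₃ = none

namespace SEData

/-! #### The redex

The flow `A` together with one new interaction, one new cointeraction, and one new edge, the simple
edge, that joins them; the edge `e₂` becomes the other lower edge of the interaction, and `e₃`
becomes the other upper edge of the cointeraction. -/

/-- The vertices of the redex. -/
inductive RedexVertex (d : SEData.{w}) : Type w
  | old (ν : d.A.V)
  | inter
  | cointer

/-- The edges of the redex. -/
inductive RedexEdge (d : SEData.{w}) : Type w
  | old (e : d.A.E)
  | simple

open Classical in
/-- The redex. -/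
noncomputable abbrev redex (d : SEData.{w}) : FlowGraph.{w} where
  V := RedexVertex d
  E := RedexEdge d
  η
    | .old ν => d.A.η ν
    | .inter => .interaction
    | .cointer => .cointeraction
  up
    | .old e => if e = d.e₂ then some .inter else (d.A.up e).map .old
    | .simple => some .inter
  lo
    | .old e => if e = d.e₃ then some .cointer else (d.A.lo e).map .old
    | .simple => some .cointer

lemma isSimpleEdge_simple (d : SEData.{w}) : d.redex.IsSimpleEdge .simple :=
  ⟨.inter, .cointer, rfl, rfl, rfl, rfl⟩

/-! #### The contractum

Two copies of `A`, marked `hat` and `tilde`, in which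
* the copies of the edge `e₂` in `hat` and of the edge `e₃` in `tilde` are identified;
* the copy of `e₂` in `tilde` comes from a weakening;
* the copy of `e₃` in `hat` ends in a coweakening;
* for every upper edge `e ≠ e₂` of `A` there is a new upper edge, which ends in a cocontraction
  whose lower edges are the two copies of `e`;
* for every lower edge `e ≠ e₃` of `A` there is a new lower edge, which comes from a contraction
  whose upper edges are the two copies of `e`. -/

/-- The upper edges of `A` different from `e₂`. -/
abbrev Upper (d : SEData.{w}) : Type w := {e : d.A.E // d.A.up e = none ∧ e ≠ d.e₂}

/-- The lower edges of `A` different from `e₃`. -/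
abbrev Lower (d : SEData.{w}) : Type w := {e : d.A.E // d.A.lo e = none ∧ e ≠ d.e₃}

/-- The vertices of the contractum. -/
inductive CVertex (d : SEData.{w}) : Type w
  | hat (ν : d.A.V)
  | tilde (ν : d.A.V)
  | weak
  | coweak
  | cocontr (e : Upper d)
  | contr (e : Lower d)

/-- The edges of the contractum; `tilde e₃` is also the copy of `e₂` in `hat`. -/
inductive CEdge (d : SEData.{w}) : Type w
  | hat (e : {e : d.A.E // e ≠ d.e₂})
  | tilde (e : d.A.E)
  | upper (e : Upper d)
  | lower (e : Lower d)

/-- The upper vertex of the copy in `hat` of an edge other than `e₂`. -/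
def hatUp (d : SEData.{w}) (e : d.A.E) (h : e ≠ d.e₂) : CVertex d :=
  match hν : d.A.up e with
  | some ν => .hat ν
  | none => .cocontr ⟨e, hν, h⟩

open Classical in
/-- The upper vertex of the copy in `tilde` of an edge. -/
noncomputable def tildeUp (d : SEData.{w}) (e : d.A.E) : CVertex d :=
  if h : e = d.e₂ then .weak else
  match hν : d.A.up e with
  | some ν => .tilde ν
  | none => .cocontr ⟨e, hν, h⟩

open Classical in
/-- The lower vertex of the copy in `hat` of an edge. -/
noncomputable def hatLo (d : SEData.{w}) (e : d.A.E) : CVertex d :=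
  if h : e = d.e₃ then .coweak else
  match hν : d.A.lo e with
  | some ν => .hat ν
  | none => .contr ⟨e, hν, h⟩

open Classical in
/-- The lower vertex of the copy in `tilde` of an edge; the copy of `e₃` continues as the copy of
`e₂` in `hat`. -/
noncomputable def tildeLo (d : SEData.{w}) (e : d.A.E) : CVertex d :=
  if h : e = d.e₃ then d.hatLo d.e₂ else
  match hν : d.A.lo e with
  | some ν => .tilde ν
  | none => .contr ⟨e, hν, h⟩

/-- The contractum. -/
noncomputable abbrev contractum (d : SEData.{w}) : FlowGraph.{w} where
  V := CVertex d
  E := CEdge d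
  η
    | .hat ν => d.A.η ν
    | .tilde ν => d.A.η ν
    | .weak => .weakening
    | .coweak => .coweakening
    | .cocontr _ => .cocontraction
    | .contr _ => .contraction
  up
    | .hat e => some (d.hatUp e.1 e.2)
    | .tilde e => some (d.tildeUp e)
    | .upper _ => none
    | .lower e => some (.contr e)
  lo
    | .hat e => some (d.hatLo e.1)
    | .tilde e => some (d.tildeLo e)
    | .upper e => some (.cocontr e)
    | .lower _ => none

/-! #### The contractum is a flow -/

section ContractumIsFlow

set_option linter.unusedSimpArgs false

variable (d : SEData.{w})

lemma hatUp_of_some {e : d.A.E} {ν : d.A.V} (h : e ≠ d.e₂) (hν : d.A.up e = some ν) :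
    d.hatUp e h = .hat ν := by
  unfold hatUp; split <;> simp_all

lemma hatUp_of_none {e : d.A.E} (h : e ≠ d.e₂) (hν : d.A.up e = none) :
    d.hatUp e h = .cocontr ⟨e, hν, h⟩ := by
  unfold hatUp; split <;> simp_all

lemma tildeUp_e₂ : d.tildeUp d.e₂ = .weak := by
  simp [tildeUp]

lemma tildeUp_of_some {e : d.A.E} {ν : d.A.V} (hν : d.A.up e = some ν) :
    d.tildeUp e = .tilde ν := by
  have h : e ≠ d.e₂ := by rintro rfl; simp [d.up_e₂] at hν
  unfold tildeUp; rw [dif_neg h]; split <;> simp_all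

lemma tildeUp_of_none {e : d.A.E} (h : e ≠ d.e₂) (hν : d.A.up e = none) :
    d.tildeUp e = .cocontr ⟨e, hν, h⟩ := by
  unfold tildeUp; rw [dif_neg h]; split <;> simp_all

lemma hatLo_e₃ : d.hatLo d.e₃ = .coweak := by
  simp [hatLo]

lemma hatLo_of_some {e : d.A.E} {ν : d.A.V} (hν : d.A.lo e = some ν) :
    d.hatLo e = .hat ν := by
  have h : e ≠ d.e₃ := by rintro rfl; simp [d.lo_e₃] at hν
  unfold hatLo; rw [dif_neg h]; split <;> simp_all

lemma hatLo_of_none {e : d.A.E} (h : e ≠ d.e₃) (hν : d.A.lo e = none) :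
    d.hatLo e = .contr ⟨e, hν, h⟩ := by
  unfold hatLo; rw [dif_neg h]; split <;> simp_all

lemma tildeLo_e₃ : d.tildeLo d.e₃ = d.hatLo d.e₂ := by
  simp [tildeLo]

lemma tildeLo_of_some {e : d.A.E} {ν : d.A.V} (hν : d.A.lo e = some ν) :
    d.tildeLo e = .tilde ν := by
  have h : e ≠ d.e₃ := by rintro rfl; simp [d.lo_e₃] at hν
  unfold tildeLo; rw [dif_neg h]; split <;> simp_all

lemma tildeLo_of_none {e : d.A.E} (h : e ≠ d.e₃) (hν : d.A.lo e = none) :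
    d.tildeLo e = .contr ⟨e, hν, h⟩ := by
  unfold tildeLo; rw [dif_neg h]; split <;> simp_all

open Classical in
/-- The copy in `hat` of an edge of `A`. -/
noncomputable def hatEdge (e : d.A.E) : d.contractum.E :=
  if h : e = d.e₂ then .tilde d.e₃ else .hat ⟨e, h⟩

/-- The copy in `tilde` of an edge of `A`. -/
def tildeEdge (e : d.A.E) : d.contractum.E := .tilde e

lemma hatEdge_injective : Function.Injective d.hatEdge := by
  intro e e' h
  unfold hatEdge at h
  split at h <;> split at h <;> first | (subst_vars; rfl) | (injection h with h; simpa using h) | cases h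

lemma tildeEdge_injective : Function.Injective d.tildeEdge := by
  intro e e' h
  injection h

lemma upHat_cases (e : d.A.E) (h : e ≠ d.e₂) :
    (∃ ν, d.A.up e = some ν ∧ d.hatUp e h = .hat ν) ∨
    (∃ hν : d.A.up e = none, d.hatUp e h = .cocontr ⟨e, hν, h⟩) := by
  obtain hu | ⟨ν, hu⟩ := Option.eq_none_or_eq_some (d.A.up e)
  · exact .inr ⟨hu, d.hatUp_of_none h hu⟩
  · exact .inl ⟨ν, hu, d.hatUp_of_some h hu⟩

lemma upTilde_cases (e : d.A.E) :
    (∃ ν, d.A.up e = some ν ∧ d.tildeUp e = .tilde ν) ∨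
    (e = d.e₂ ∧ d.tildeUp e = .weak) ∨
    (∃ (h : e ≠ d.e₂) (hν : d.A.up e = none), d.tildeUp e = .cocontr ⟨e, hν, h⟩) := by
  obtain hu | ⟨ν, hu⟩ := Option.eq_none_or_eq_some (d.A.up e)
  · by_cases h : e = d.e₂
    · subst h; exact .inr (.inl ⟨rfl, d.tildeUp_e₂⟩)
    · exact .inr (.inr ⟨h, hu, d.tildeUp_of_none h hu⟩)
  · exact .inl ⟨ν, hu, d.tildeUp_of_some hu⟩

lemma loHat_cases (e : d.A.E) :
    (∃ ν, d.A.lo e = some ν ∧ d.hatLo e = .hat ν) ∨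
    (e = d.e₃ ∧ d.hatLo e = .coweak) ∨
    (∃ (h : e ≠ d.e₃) (hν : d.A.lo e = none), d.hatLo e = .contr ⟨e, hν, h⟩) := by
  obtain hu | ⟨ν, hu⟩ := Option.eq_none_or_eq_some (d.A.lo e)
  · by_cases h : e = d.e₃
    · subst h; exact .inr (.inl ⟨rfl, d.hatLo_e₃⟩)
    · exact .inr (.inr ⟨h, hu, d.hatLo_of_none h hu⟩)
  · exact .inl ⟨ν, hu, d.hatLo_of_some hu⟩

lemma loTilde_cases (e : d.A.E) :
    (∃ ν, d.A.lo e = some ν ∧ d.tildeLo e = .tilde ν) ∨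
    (e = d.e₃ ∧ d.tildeLo e = d.hatLo d.e₂) ∨
    (∃ (h : e ≠ d.e₃) (hν : d.A.lo e = none), d.tildeLo e = .contr ⟨e, hν, h⟩) := by
  obtain hu | ⟨ν, hu⟩ := Option.eq_none_or_eq_some (d.A.lo e)
  · by_cases h : e = d.e₃
    · subst h; exact .inr (.inl ⟨rfl, d.tildeLo_e₃⟩)
    · exact .inr (.inr ⟨h, hu, d.tildeLo_of_none h hu⟩)
  · exact .inl ⟨ν, hu, d.tildeLo_of_some hu⟩

lemma lower_hat (ν : d.A.V) :
    d.contractum.lowerEdges (some (.hat ν)) = d.hatEdge '' d.A.lowerEdges (some ν) := by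
  ext x
  simp only [FlowGraph.lowerEdges, Set.mem_ofPred_eq, Set.mem_image]
  constructor
  · intro h
    rcases x with ⟨e, he⟩ | e | e | e <;> simp only [contractum, Option.some.injEq] at h
    · rcases d.upHat_cases e he with ⟨μ, h1, h2⟩ | ⟨h1, h2⟩ <;> rw [h2] at h <;> cases h
      exact ⟨e, h1, by simp [hatEdge, he]⟩
    · rcases d.upTilde_cases e with ⟨μ, h1, h2⟩ | ⟨h1, h2⟩ | ⟨h1, h3, h2⟩ <;> rw [h2] at h <;> cases h
    · cases h
    · cases h
  · rintro ⟨e, he, rfl⟩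
    have h : e ≠ d.e₂ := by rintro rfl; simp [d.up_e₂] at he
    simp [hatEdge, h, contractum, d.hatUp_of_some h he]

lemma lower_tilde (ν : d.A.V) :
    d.contractum.lowerEdges (some (.tilde ν)) = d.tildeEdge '' d.A.lowerEdges (some ν) := by
  ext x
  simp only [FlowGraph.lowerEdges, Set.mem_ofPred_eq, Set.mem_image]
  constructor
  · intro h
    rcases x with ⟨e, he⟩ | e | e | e <;> simp only [contractum, Option.some.injEq] at h
    · rcases d.upHat_cases e he with ⟨μ, h1, h2⟩ | ⟨h1, h2⟩ <;> rw [h2] at h <;> cases h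
    · rcases d.upTilde_cases e with ⟨μ, h1, h2⟩ | ⟨h1, h2⟩ | ⟨h1, h3, h2⟩ <;> rw [h2] at h <;> cases h
      exact ⟨e, h1, rfl⟩
    · cases h
    · cases h
  · rintro ⟨e, he, rfl⟩
    simp [tildeEdge, contractum, d.tildeUp_of_some he]

lemma upper_hat (ν : d.A.V) :
    d.contractum.upperEdges (some (.hat ν)) = d.hatEdge '' d.A.upperEdges (some ν) := by
  ext x
  simp only [FlowGraph.upperEdges, Set.mem_ofPred_eq, Set.mem_image]
  constructor
  · intro h
    rcases x with ⟨e, he⟩ | e | e | e <;> simp only [contractum, Option.some.injEq] at h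
    · rcases d.loHat_cases e with ⟨μ, h1, h2⟩ | ⟨h1, h2⟩ | ⟨h1, h3, h2⟩ <;> rw [h2] at h <;> cases h
      exact ⟨e, h1, by simp [hatEdge, he]⟩
    · rcases d.loTilde_cases e with ⟨μ, h1, h2⟩ | ⟨rfl, h2⟩ | ⟨h1, h3, h2⟩ <;> rw [h2] at h
      · cases h
      · rcases d.loHat_cases d.e₂ with ⟨μ, h1, h2⟩ | ⟨h1, h2⟩ | ⟨h1, h3, h2⟩ <;> rw [h2] at h <;>
          cases h
        exact ⟨d.e₂, h1, by simp [hatEdge]⟩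
      · cases h
    · cases h
    · cases h
  · rintro ⟨e, he, rfl⟩
    by_cases h : e = d.e₂
    · subst h
      simp [hatEdge, contractum, d.tildeLo_e₃, d.hatLo_of_some he]
    · simp [hatEdge, h, contractum, d.hatLo_of_some he]

lemma upper_tilde (ν : d.A.V) :
    d.contractum.upperEdges (some (.tilde ν)) = d.tildeEdge '' d.A.upperEdges (some ν) := by
  ext x
  simp only [FlowGraph.upperEdges, Set.mem_ofPred_eq, Set.mem_image]
  constructor
  · intro h
    rcases x with ⟨e, he⟩ | e | e | e <;> simp only [contractum, Option.some.injEq] at h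
    · rcases d.loHat_cases e with ⟨μ, h1, h2⟩ | ⟨h1, h2⟩ | ⟨h1, h3, h2⟩ <;> rw [h2] at h <;> cases h
    · rcases d.loTilde_cases e with ⟨μ, h1, h2⟩ | ⟨rfl, h2⟩ | ⟨h1, h3, h2⟩ <;> rw [h2] at h
      · cases h
        exact ⟨e, h1, rfl⟩
      · rcases d.loHat_cases d.e₂ with ⟨μ, h1, h2⟩ | ⟨h1, h2⟩ | ⟨h1, h3, h2⟩ <;> rw [h2] at h <;>
          cases h
      · cases h
    · cases h
    · cases h
  · rintro ⟨e, he, rfl⟩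
    simp [tildeEdge, contractum, d.tildeLo_of_some he]

lemma lower_weak : d.contractum.lowerEdges (some .weak) = {d.tildeEdge d.e₂} := by
  ext x
  simp only [FlowGraph.lowerEdges, Set.mem_ofPred_eq, Set.mem_singleton_iff]
  constructor
  · intro h
    rcases x with ⟨e, he⟩ | e | e | e <;> simp only [contractum, Option.some.injEq] at h
    · rcases d.upHat_cases e he with ⟨μ, h1, h2⟩ | ⟨h1, h2⟩ <;> rw [h2] at h <;> cases h
    · rcases d.upTilde_cases e with ⟨μ, h1, h2⟩ | ⟨h1, h2⟩ | ⟨h1, h3, h2⟩ <;> rw [h2] at h <;> cases h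
      rw [h1]; rfl
    · cases h
    · cases h
  · rintro rfl
    simp [tildeEdge, contractum, d.tildeUp_e₂]

lemma upper_weak : d.contractum.upperEdges (some .weak) = ∅ := by
  ext x
  simp only [FlowGraph.upperEdges, Set.mem_ofPred_eq, Set.mem_empty_iff_false, iff_false]
  intro h
  rcases x with ⟨e, he⟩ | e | e | e <;> simp only [contractum, Option.some.injEq] at h
  · rcases d.loHat_cases e with ⟨μ, h1, h2⟩ | ⟨h1, h2⟩ | ⟨h1, h3, h2⟩ <;> rw [h2] at h <;> cases h
  · rcases d.loTilde_cases e with ⟨μ, h1, h2⟩ | ⟨rfl, h2⟩ | ⟨h1, h3, h2⟩ <;> rw [h2] at h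
    · cases h
    · rcases d.loHat_cases d.e₂ with ⟨μ, h1, h2⟩ | ⟨h1, h2⟩ | ⟨h1, h3, h2⟩ <;> rw [h2] at h <;>
        cases h
    · cases h
  · cases h
  · cases h

lemma lower_coweak : d.contractum.lowerEdges (some .coweak) = ∅ := by
  ext x
  simp only [FlowGraph.lowerEdges, Set.mem_ofPred_eq, Set.mem_empty_iff_false, iff_false]
  intro h
  rcases x with ⟨e, he⟩ | e | e | e <;> simp only [contractum, Option.some.injEq] at h
  · rcases d.upHat_cases e he with ⟨μ, h1, h2⟩ | ⟨h1, h2⟩ <;> rw [h2] at h <;> cases h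
  · rcases d.upTilde_cases e with ⟨μ, h1, h2⟩ | ⟨h1, h2⟩ | ⟨h1, h3, h2⟩ <;> rw [h2] at h <;> cases h
  · cases h
  · cases h

lemma upper_coweak : d.contractum.upperEdges (some .coweak) = {d.hatEdge d.e₃} := by
  ext x
  simp only [FlowGraph.upperEdges, Set.mem_ofPred_eq, Set.mem_singleton_iff]
  constructor
  · intro h
    rcases x with ⟨e, he⟩ | e | e | e <;> simp only [contractum, Option.some.injEq] at h
    · rcases d.loHat_cases e with ⟨μ, h1, h2⟩ | ⟨rfl, h2⟩ | ⟨h1, h3, h2⟩ <;> rw [h2] at h <;>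
        cases h
      simp [hatEdge, he]
    · rcases d.loTilde_cases e with ⟨μ, h1, h2⟩ | ⟨rfl, h2⟩ | ⟨h1, h3, h2⟩ <;> rw [h2] at h
      · cases h
      · rcases d.loHat_cases d.e₂ with ⟨μ, h1, h2⟩ | ⟨h1, h2⟩ | ⟨h1, h3, h2⟩ <;> rw [h2] at h <;>
          cases h
        simp [hatEdge, h1]
      · cases h
    · cases h
    · cases h
  · rintro rfl
    by_cases h : d.e₃ = d.e₂
    · simp [hatEdge, h, contractum]
      simp [← h, d.tildeLo_e₃, d.hatLo_e₃]
    · simp [hatEdge, h, contractum, d.hatLo_e₃]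

lemma lower_cocontr (e : Upper d) :
    d.contractum.lowerEdges (some (.cocontr e)) = {d.hatEdge e.1, d.tildeEdge e.1} := by
  obtain ⟨e, hu, hne⟩ := e
  ext x
  simp only [FlowGraph.lowerEdges, Set.mem_ofPred_eq, Set.mem_insert_iff, Set.mem_singleton_iff]
  constructor
  · intro h
    rcases x with ⟨e', he⟩ | e' | e' | e' <;> simp only [contractum, Option.some.injEq] at h
    · rcases d.upHat_cases e' he with ⟨μ, h1, h2⟩ | ⟨h1, h2⟩ <;> rw [h2] at h <;> cases h
      left; simp [hatEdge, he]
    · rcases d.upTilde_cases e' with ⟨μ, h1, h2⟩ | ⟨h1, h2⟩ | ⟨h1, h3, h2⟩ <;> rw [h2] at h <;>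
        cases h
      right; rfl
    · cases h
    · cases h
  · rintro (rfl | rfl)
    · simp [hatEdge, hne, contractum, d.hatUp_of_none hne hu]
    · simp [tildeEdge, contractum, d.tildeUp_of_none hne hu]

lemma upper_cocontr (e : Upper d) :
    d.contractum.upperEdges (some (.cocontr e)) = {CEdge.upper e} := by
  ext x
  simp only [FlowGraph.upperEdges, Set.mem_ofPred_eq, Set.mem_singleton_iff]
  constructor
  · intro h
    rcases x with ⟨e', he⟩ | e' | e' | e' <;> simp only [contractum, Option.some.injEq] at h
    · rcases d.loHat_cases e' with ⟨μ, h1, h2⟩ | ⟨h1, h2⟩ | ⟨h1, h3, h2⟩ <;> rw [h2] at h <;> cases h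
    · rcases d.loTilde_cases e' with ⟨μ, h1, h2⟩ | ⟨rfl, h2⟩ | ⟨h1, h3, h2⟩ <;> rw [h2] at h
      · cases h
      · rcases d.loHat_cases d.e₂ with ⟨μ, h1, h2⟩ | ⟨h1, h2⟩ | ⟨h1, h3, h2⟩ <;> rw [h2] at h <;>
          cases h
      · cases h
    · cases h; rfl
    · cases h
  · rintro rfl
    simp [contractum]

lemma lower_contr (e : Lower d) :
    d.contractum.lowerEdges (some (.contr e)) = {CEdge.lower e} := by
  ext x
  simp only [FlowGraph.lowerEdges, Set.mem_ofPred_eq, Set.mem_singleton_iff]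
  constructor
  · intro h
    rcases x with ⟨e', he⟩ | e' | e' | e' <;> simp only [contractum, Option.some.injEq] at h
    · rcases d.upHat_cases e' he with ⟨μ, h1, h2⟩ | ⟨h1, h2⟩ <;> rw [h2] at h <;> cases h
    · rcases d.upTilde_cases e' with ⟨μ, h1, h2⟩ | ⟨h1, h2⟩ | ⟨h1, h3, h2⟩ <;> rw [h2] at h <;>
        cases h
    · cases h
    · cases h; rfl
  · rintro rfl
    simp [contractum]

lemma upper_contr (e : Lower d) :
    d.contractum.upperEdges (some (.contr e)) = {d.hatEdge e.1, d.tildeEdge e.1} := by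
  obtain ⟨e, hu, hne⟩ := e
  ext x
  simp only [FlowGraph.upperEdges, Set.mem_ofPred_eq, Set.mem_insert_iff, Set.mem_singleton_iff]
  constructor
  · intro h
    rcases x with ⟨e', he⟩ | e' | e' | e' <;> simp only [contractum, Option.some.injEq] at h
    · rcases d.loHat_cases e' with ⟨μ, h1, h2⟩ | ⟨h1, h2⟩ | ⟨h1, h3, h2⟩ <;> rw [h2] at h <;>
        cases h
      left; simp [hatEdge, he]
    · rcases d.loTilde_cases e' with ⟨μ, h1, h2⟩ | ⟨rfl, h2⟩ | ⟨h1, h3, h2⟩ <;> rw [h2] at h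
      · cases h
      · rcases d.loHat_cases d.e₂ with ⟨μ, h1, h2⟩ | ⟨h1, h2⟩ | ⟨h1, h3, h2⟩ <;> rw [h2] at h <;>
          cases h
        left; simp [hatEdge]
      · cases h
        right; rfl
    · cases h
    · cases h
  · rintro (rfl | rfl)
    · by_cases h : e = d.e₂
      · subst h
        simp [hatEdge, contractum, d.tildeLo_e₃, d.hatLo_of_none hne hu]
      · simp [hatEdge, h, contractum, d.hatLo_of_none hne hu]
    · simp [tildeEdge, contractum, d.tildeLo_of_none hne hu]

lemma hatEdge_ne_tildeEdge {e : d.A.E} (h : e ≠ d.e₂ ∨ e ≠ d.e₃) :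
    d.hatEdge e ≠ d.tildeEdge e := by
  unfold hatEdge tildeEdge
  split
  · intro h'; injection h' with h'; subst_vars; simp_all
  · intro h'; cases h'

lemma finite_contractum : Finite d.contractum.V ∧ Finite d.contractum.E := by
  have := d.A.isFlow.finite_V
  have := d.A.isFlow.finite_E
  constructor
  · refine Finite.of_surjective
      (fun x : (d.A.V ⊕ d.A.V) ⊕ (Bool ⊕ (Upper d ⊕ Lower d)) => (match x with
        | .inl (.inl ν) => .hat ν
        | .inl (.inr ν) => .tilde ν
        | .inr (.inl true) => .weak
        | .inr (.inl false) => .coweak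
        | .inr (.inr (.inl e)) => .cocontr e
        | .inr (.inr (.inr e)) => .contr e : CVertex d)) ?_
    rintro (ν | ν | _ | _ | e | e)
    · exact ⟨.inl (.inl ν), rfl⟩
    · exact ⟨.inl (.inr ν), rfl⟩
    · exact ⟨.inr (.inl true), rfl⟩
    · exact ⟨.inr (.inl false), rfl⟩
    · exact ⟨.inr (.inr (.inl e)), rfl⟩
    · exact ⟨.inr (.inr (.inr e)), rfl⟩
  · refine Finite.of_surjective
      (fun x : ({e : d.A.E // e ≠ d.e₂} ⊕ d.A.E) ⊕ (Upper d ⊕ Lower d) => (match x with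
        | .inl (.inl e) => .hat e
        | .inl (.inr e) => .tilde e
        | .inr (.inl e) => .upper e
        | .inr (.inr e) => .lower e : CEdge d)) ?_
    rintro (e | e | e | e)
    · exact ⟨.inl (.inl e), rfl⟩
    · exact ⟨.inl (.inr e), rfl⟩
    · exact ⟨.inr (.inl e), rfl⟩
    · exact ⟨.inr (.inr e), rfl⟩

lemma acyclic_contractum (x : d.contractum.E) :
    ¬ Relation.TransGen d.contractum.Follows x x := by
  let stage : d.contractum.E → ℕ := fun x => match x with
    | .upper _ => 0
    | .tilde _ => 1
    | .hat _ => 2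
    | .lower _ => 3
  let P : d.contractum.E → d.contractum.E → Prop := fun x y =>
    stage x < stage y ∨
    (∃ e e', x = CEdge.tilde e ∧ y = CEdge.tilde e' ∧ Relation.TransGen d.A.Follows e e') ∨
    (∃ e e', x = CEdge.hat e ∧ y = CEdge.hat e' ∧ Relation.TransGen d.A.Follows e.1 e'.1)
  have hP : ∀ {x y}, Relation.TransGen d.contractum.Follows x y → P x y := by
    intro x y h
    have trans : ∀ {x y z}, P x y → P y z → P x z := by
      rintro x y z (h | ⟨e, e', rfl, rfl, h⟩ | ⟨e, e', rfl, rfl, h⟩)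
        (h' | ⟨f, f', h1, rfl, h'⟩ | ⟨f, f', h1, rfl, h'⟩)
      · exact .inl (h.trans h')
      · subst h1; exact .inl h
      · subst h1; exact .inl h
      · exact .inl h'
      · cases h1; exact .inr (.inl ⟨_, _, rfl, rfl, h.trans h'⟩)
      · cases h1
      · exact .inl h'
      · cases h1
      · cases h1; exact .inr (.inr ⟨_, _, rfl, rfl, h.trans h'⟩)
    have base : ∀ {x y}, d.contractum.Follows x y → P x y := by
      rintro x y ⟨ν, h1, h2⟩
      change x ∈ d.contractum.upperEdges (some ν) at h1
      change y ∈ d.contractum.lowerEdges (some ν) at h2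
      rcases ν with ν | ν | _ | _ | e | e
      · rw [upper_hat] at h1; rw [lower_hat] at h2
        obtain ⟨e, he, rfl⟩ := h1
        obtain ⟨e', he', rfl⟩ := h2
        have h : e' ≠ d.e₂ := by rintro rfl; simp [FlowGraph.lowerEdges, d.up_e₂] at he'
        by_cases h' : e = d.e₂
        · left; simp [hatEdge, h, h', stage]
        · right; right
          exact ⟨⟨e, h'⟩, ⟨e', h⟩, by simp [hatEdge, h'], by simp [hatEdge, h],
            .single ⟨ν, he, he'⟩⟩
      · rw [upper_tilde] at h1; rw [lower_tilde] at h2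
        obtain ⟨e, he, rfl⟩ := h1
        obtain ⟨e', he', rfl⟩ := h2
        exact .inr (.inl ⟨e, e', rfl, rfl, .single ⟨ν, he, he'⟩⟩)
      · rw [upper_weak] at h1; exact h1.elim
      · rw [lower_coweak] at h2; exact h2.elim
      · rw [upper_cocontr] at h1; rw [lower_cocontr] at h2
        rcases h1 with rfl
        left
        rcases h2 with rfl | rfl
        · simp [hatEdge, e.2.2, stage]
        · simp [tildeEdge, stage]
      · rw [upper_contr] at h1; rw [lower_contr] at h2
        rcases h2 with rfl
        left
        rcases h1 with rfl | rfl
        · unfold hatEdge; split <;> simp [stage]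
        · simp [tildeEdge, stage]
    induction h with
    | single h => exact base h
    | tail _ h ih => exact trans ih (base h)
  intro h
  rcases hP h with h | ⟨e, e', rfl, h', h⟩ | ⟨e, e', rfl, h', h⟩
  · exact lt_irrefl _ h
  · cases h'; exact d.A.isFlow.acyclic _ h
  · cases h'; exact d.A.isFlow.acyclic _ h

lemma edgesOf_hat (ν : d.A.V) :
    d.contractum.edgesOf (.hat ν) = d.hatEdge '' d.A.edgesOf ν := by
  unfold FlowGraph.edgesOf
  rw [lower_hat, upper_hat, Set.image_union]

lemma edgesOf_tilde (ν : d.A.V) :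
    d.contractum.edgesOf (.tilde ν) = d.tildeEdge '' d.A.edgesOf ν := by
  unfold FlowGraph.edgesOf
  rw [lower_tilde, upper_tilde, Set.image_union]

/-- The edges of an old vertex in the redex. -/
lemma edgesOf_redex_old (ν : d.A.V) :
    d.redex.edgesOf (.old ν) = RedexEdge.old '' d.A.edgesOf ν := by
  ext x
  simp only [FlowGraph.edgesOf, FlowGraph.lowerEdges, FlowGraph.upperEdges, Set.mem_union,
    Set.mem_ofPred_eq, Set.mem_image]
  rcases x with e | _
  · have h2 := d.up_e₂
    have h3 := d.lo_e₃
    by_cases he2 : e = d.e₂ <;> by_cases he3 : e = d.e₃ <;> simp [redex, he2, he3] <;> aesop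
  · simp [redex]

lemma edgesOf_redex_inter :
    d.redex.edgesOf .inter = {RedexEdge.old d.e₂, RedexEdge.simple} := by
  ext x
  simp only [FlowGraph.edgesOf, FlowGraph.lowerEdges, FlowGraph.upperEdges, Set.mem_union,
    Set.mem_ofPred_eq, Set.mem_insert_iff, Set.mem_singleton_iff]
  rcases x with e | _
  · by_cases he2 : e = d.e₂ <;> by_cases he3 : e = d.e₃ <;> simp [redex, he2, he3]
  · simp [redex]

lemma edgesOf_redex_cointer :
    d.redex.edgesOf .cointer = {RedexEdge.old d.e₃, RedexEdge.simple} := by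
  ext x
  simp only [FlowGraph.edgesOf, FlowGraph.lowerEdges, FlowGraph.upperEdges, Set.mem_union,
    Set.mem_ofPred_eq, Set.mem_insert_iff, Set.mem_singleton_iff]
  rcases x with e | _
  · by_cases he2 : e = d.e₂ <;> by_cases he3 : e = d.e₃ <;> simp [redex, he2, he3]
  · simp [redex]

lemma polarity_contractum (h : d.redex.IsFlow) : ∃ ρ, d.contractum.IsPolarity ρ := by
  obtain ⟨π, hπ⟩ := h.polarity
  have h23 : π (.old d.e₂) = π (.old d.e₃) := by
    have h1 := (hπ .inter).2 (.inl rfl)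
    have h2 := (hπ .cointer).2 (.inr rfl)
    rw [edgesOf_redex_inter, Set.image_pair] at h1
    rw [edgesOf_redex_cointer, Set.image_pair] at h2
    have key : ∀ a b c : Bool, ({a, c} : Set Bool) = {false, true} →
        ({b, c} : Set Bool) = {false, true} → a = b := by
      intro a b c h h'
      have t := Set.ext_iff.1 h (!c)
      have t' := Set.ext_iff.1 h' (!c)
      simp only [Set.mem_insert_iff, Set.mem_singleton_iff] at t t'
      revert t t'
      clear h h'
      cases a <;> cases b <;> cases c <;> decide
    exact key _ _ _ h1 h2
  let ρ : d.contractum.E → Bool := fun x => match x with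
    | .hat e => π (.old e.1)
    | .tilde e => π (.old e)
    | .upper e => π (.old e.1)
    | .lower e => π (.old e.1)
  have ρhat : ∀ e, ρ (d.hatEdge e) = π (.old e) := by
    intro e
    by_cases he : e = d.e₂
    · subst he; simp [hatEdge, ρ, h23]
    · simp [hatEdge, he, ρ]
  have ρtilde : ∀ e, ρ (d.tildeEdge e) = π (.old e) := fun e => rfl
  have bool_single : ∀ b : Bool, ({b} : Set Bool) = {false} ∨ ({b} : Set Bool) = {true} := by
    intro b; cases b <;> simp
  refine ⟨ρ, ?_⟩
  rintro (ν | ν | _ | _ | e | e)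
  · have := hπ (.old ν)
    rw [edgesOf_redex_old, Set.image_image] at this
    rw [edgesOf_hat, Set.image_image]
    simpa only [ρhat] using this
  · have := hπ (.old ν)
    rw [edgesOf_redex_old, Set.image_image] at this
    rw [edgesOf_tilde, Set.image_image]
    simpa only [ρtilde] using this
  · simp [contractum]
  · simp [contractum]
  · refine ⟨fun _ => ?_, by simp [contractum]⟩
    have : ρ '' d.contractum.edgesOf (.cocontr e) = {π (.old e.1)} := by
      unfold FlowGraph.edgesOf
      rw [lower_cocontr, upper_cocontr, Set.image_union, Set.image_pair, Set.image_singleton,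
        ρhat, ρtilde]
      simp [ρ]
    rw [this]; exact bool_single _
  · refine ⟨fun _ => ?_, by simp [contractum]⟩
    have : ρ '' d.contractum.edgesOf (.contr e) = {π (.old e.1)} := by
      unfold FlowGraph.edgesOf
      rw [lower_contr, upper_contr, Set.image_union, Set.image_pair, Set.image_singleton,
        ρhat, ρtilde]
      simp [ρ]
    rw [this]; exact bool_single _

/-- If the redex is a flow, then so is the contractum. -/
theorem contractum_isFlow (h : d.redex.IsFlow) : d.contractum.IsFlow where
  finite_V := d.finite_contractum.1
  finite_E := d.finite_contractum.2
  card_lower := by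
    rintro (ν | ν | _ | _ | e | e)
    · rw [lower_hat, Set.ncard_image_of_injective _ d.hatEdge_injective]
      exact d.A.isFlow.card_lower ν
    · rw [lower_tilde, Set.ncard_image_of_injective _ d.tildeEdge_injective]
      exact d.A.isFlow.card_lower ν
    · rw [lower_weak, Set.ncard_singleton]; rfl
    · rw [lower_coweak, Set.ncard_empty]; rfl
    · rw [lower_cocontr, Set.ncard_pair (d.hatEdge_ne_tildeEdge (.inl e.2.2))]; rfl
    · rw [lower_contr, Set.ncard_singleton]; rfl
  card_upper := by
    rintro (ν | ν | _ | _ | e | e)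
    · rw [upper_hat, Set.ncard_image_of_injective _ d.hatEdge_injective]
      exact d.A.isFlow.card_upper ν
    · rw [upper_tilde, Set.ncard_image_of_injective _ d.tildeEdge_injective]
      exact d.A.isFlow.card_upper ν
    · rw [upper_weak, Set.ncard_empty]; rfl
    · rw [upper_coweak, Set.ncard_singleton]; rfl
    · rw [upper_cocontr, Set.ncard_singleton]; rfl
    · rw [upper_contr, Set.ncard_pair (d.hatEdge_ne_tildeEdge (.inr e.2.2))]; rfl
  acyclic := d.acyclic_contractum
  polarity := d.polarity_contractum h

/-- The upper edges of the redex and of the contractum correspond to each other. -/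
lemma upper_correspondence :
    Nonempty (d.redex.lowerEdges none ≃ d.contractum.lowerEdges none) := by
  have f : d.redex.lowerEdges none ≃ Upper d := by
    refine (Equiv.ofBijective
      (fun e : Upper d => (⟨RedexEdge.old e.1, ?_⟩ : d.redex.lowerEdges none)) ⟨?_, ?_⟩).symm
    · simp [FlowGraph.lowerEdges, redex, e.2.2, e.2.1]
    · intro e e' h
      simpa [Subtype.ext_iff] using h
    · rintro ⟨e | _, he⟩
      · by_cases h : e = d.e₂
        · simp [FlowGraph.lowerEdges, redex, h] at he
        · exact ⟨⟨e, by simpa [FlowGraph.lowerEdges, redex, h] using he, h⟩, rfl⟩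
      · simp [FlowGraph.lowerEdges, redex] at he
  have g : d.contractum.lowerEdges none ≃ Upper d := by
    refine (Equiv.ofBijective
      (fun e : Upper d => (⟨CEdge.upper e, ?_⟩ : d.contractum.lowerEdges none)) ⟨?_, ?_⟩).symm
    · simp [FlowGraph.lowerEdges, contractum]
    · intro e e' h
      simpa [Subtype.ext_iff] using h
    · rintro ⟨e | e | e | e, he⟩
      · simp [FlowGraph.lowerEdges, contractum] at he
      · simp [FlowGraph.lowerEdges, contractum] at he
      · exact ⟨e, rfl⟩
      · simp [FlowGraph.lowerEdges, contractum] at he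
  exact ⟨f.trans g.symm⟩

/-- The lower edges of the redex and of the contractum correspond to each other. -/
lemma lower_correspondence :
    Nonempty (d.redex.upperEdges none ≃ d.contractum.upperEdges none) := by
  have f : d.redex.upperEdges none ≃ Lower d := by
    refine (Equiv.ofBijective
      (fun e : Lower d => (⟨RedexEdge.old e.1, ?_⟩ : d.redex.upperEdges none)) ⟨?_, ?_⟩).symm
    · simp [FlowGraph.upperEdges, redex, e.2.2, e.2.1]
    · intro e e' h
      simpa [Subtype.ext_iff] using h
    · rintro ⟨e | _, he⟩
      · by_cases h : e = d.e₃
        · simp [FlowGraph.upperEdges, redex, h] at he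
        · exact ⟨⟨e, by simpa [FlowGraph.upperEdges, redex, h] using he, h⟩, rfl⟩
      · simp [FlowGraph.upperEdges, redex] at he
  have g : d.contractum.upperEdges none ≃ Lower d := by
    refine (Equiv.ofBijective
      (fun e : Lower d => (⟨CEdge.lower e, ?_⟩ : d.contractum.upperEdges none)) ⟨?_, ?_⟩).symm
    · simp [FlowGraph.upperEdges, contractum]
    · intro e e' h
      simpa [Subtype.ext_iff] using h
    · rintro ⟨e | e | e | e, he⟩
      · simp [FlowGraph.upperEdges, contractum] at he
      · simp [FlowGraph.upperEdges, contractum] at he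
      · simp [FlowGraph.upperEdges, contractum] at he
      · exact ⟨e, rfl⟩
  exact ⟨f.trans g.symm⟩

end ContractumIsFlow

/-- The redex as an atomic flow. -/
noncomputable def redexFlow (d : SEData.{w}) (h : d.redex.IsFlow) : AtomicFlow.{w} where
  toFlowGraph := d.redex
  isFlow := h

/-- The contractum as an atomic flow. -/
noncomputable def contractumFlow (d : SEData.{w}) (h : d.redex.IsFlow) : AtomicFlow.{w} where
  toFlowGraph := d.contractum
  isFlow := d.contractum_isFlow h

end SEData

/-- Isomorphic flows have corresponding upper edges. -/
lemma FlowGraph.Iso.lowerEdges_none {F G : FlowGraph.{w}} (i : F.Iso G) :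
    Nonempty (F.lowerEdges none ≃ G.lowerEdges none) :=
  ⟨i.onE.subtypeEquiv fun e => by simp [lowerEdges, i.map_up]⟩

/-- Isomorphic flows have corresponding lower edges. -/
lemma FlowGraph.Iso.upperEdges_none {F G : FlowGraph.{w}} (i : F.Iso G) :
    Nonempty (F.upperEdges none ≃ G.upperEdges none) :=
  ⟨i.onE.subtypeEquiv fun e => by simp [upperEdges, i.map_lo]⟩

/-- `B` reduces to `C` by eliminating one simple edge, with flows taken up to isomorphism. -/
def SimpleEdgeReduces (B C : AtomicFlow.{w}) : Prop :=
  ∃ (d : SEData.{w}) (h : d.redex.IsFlow),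
    Nonempty (FlowGraph.Iso B.toFlowGraph (d.redexFlow h).toFlowGraph) ∧
    Nonempty (FlowGraph.Iso C.toFlowGraph (d.contractumFlow h).toFlowGraph)

/-- The reduction `se`. -/
def se : Reduction.{w} where
  rel := SimpleEdgeReduces
  upper := by
    rintro C D ⟨d, _, ⟨i⟩, ⟨j⟩⟩
    obtain ⟨f⟩ := i.lowerEdges_none
    obtain ⟨g⟩ := j.lowerEdges_none
    obtain ⟨k⟩ := d.upper_correspondence
    exact ⟨(f.trans k).trans g.symm⟩
  lower := by
    rintro C D ⟨d, _, ⟨i⟩, ⟨j⟩⟩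
    obtain ⟨f⟩ := i.upperEdges_none
    obtain ⟨g⟩ := j.upperEdges_none
    obtain ⟨k⟩ := d.lower_correspondence
    exact ⟨(f.trans k).trans g.symm⟩

end AtomicFlows

namespace AtomicFlows

universe u v w w'

open Formula DualAtoms

/-! Let the simple edge carry the atom `x`, let `α` and `β` be the premiss and the conclusion, and
write `x̄` for `dual x`. The derivation is used twice, with the occurrences of `x` on the simple
edge replaced by a unit.

In the copy `hat` they become `ff`. The cointeraction turns into `(ff ∧ x̄) → ff`, which is one
coweakening. The interaction turns into `tt → [ff ∨ x̄]`, which has no reason to be derivable, but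
`(x̄ ∧ tt) → [ff ∨ x̄]` holds by linear rules alone. A conjunct `x̄` added to the premiss can be
carried down to that step, so the copy gives `(x̄ ∧ α̂) → β̂`. In the copy `tilde` they become `tt`.
Dually, the interaction costs one weakening, the cointeraction emits `x̄` instead of destroying it,
and the copy gives `α̃ → [β̃ ∨ x̄]`.

The two copies compose to `α → (α̂ ∧ α̃) → (α̂ ∧ [β̃ ∨ x̄]) → [(x̄ ∧ α̂) ∨ β̃] → [β̂ ∨ β̃] → β`,
with cocontractions at the top, a switch in the middle and contractions at the bottom. The `x̄` that
leaves `tilde` and enters `hat` is the identified edge of the contractum.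

The carrying lemmas are `Chain.derives_bind_and` and `Chain.derives_bind_or` (substitution with one
conjunct consumed or one disjunct produced), `exists_simple_atom` (the interaction and the
cointeraction agree on `x`), the generic `Derives.cocontraction` and `Derives.contraction`, and
`nodup_contractum_vertices` (each vertex of the contractum is used exactly once). -/

/-! ### Substitution in formulae -/

namespace Formula

/-- Substitute formulae for the leaves of a formula. -/
def bind {L : Type u} {M : Type v} (σ : L → Formula M) : Formula L → Formula M
  | ff => ff
  | tt => tt
  | leaf x => σ x
  | or α β => or (α.bind σ) (β.bind σ)
  | and α β => and (α.bind σ) (β.bind σ)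

variable {L : Type u} {M : Type v} {N : Type w}

lemma bind_leaf_comp (f : L → M) (α : Formula L) : α.bind (fun x => leaf (f x)) = α.map f := by
  induction α <;> simp_all [bind, map]

lemma map_map (f : L → M) (g : M → N) (α : Formula L) :
    (α.map f).map g = α.map (fun x => g (f x)) := by
  induction α <;> simp_all [map]

lemma bind_map (f : L → M) (σ : M → Formula N) (α : Formula L) :
    (α.map f).bind σ = α.bind (fun x => σ (f x)) := by
  induction α <;> simp_all [map, bind]

lemma leaves_map (f : L → M) (α : Formula L) : (α.map f).leaves = α.leaves.map f := by
  induction α <;> simp_all [map, leaves]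

/-- A formula all of whose leaves are in the range of `f` is a renaming along `f`. -/
lemma exists_map_eq (f : L → M) (α : Formula M) (h : ∀ x ∈ α.leaves, ∃ y, f y = x) :
    ∃ α₀ : Formula L, α₀.map f = α := by
  induction α with
  | ff => exact ⟨ff, rfl⟩
  | tt => exact ⟨tt, rfl⟩
  | leaf x =>
    obtain ⟨y, rfl⟩ := h x (by simp [leaves])
    exact ⟨leaf y, rfl⟩
  | or α β ihα ihβ =>
    obtain ⟨α₀, rfl⟩ := ihα fun x hx => h x (by simp [leaves, hx])
    obtain ⟨β₀, rfl⟩ := ihβ fun x hx => h x (by simp [leaves, hx])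
    exact ⟨or α₀ β₀, rfl⟩
  | and α β ihα ihβ =>
    obtain ⟨α₀, rfl⟩ := ihα fun x hx => h x (by simp [leaves, hx])
    obtain ⟨β₀, rfl⟩ := ihβ fun x hx => h x (by simp [leaves, hx])
    exact ⟨and α₀ β₀, rfl⟩

lemma erase_map {X : Type u} {I : Type v} {J : Type w} (f : I → J) (α : Formula (X × I)) :
    (α.map (Prod.map id f)).erase = α.erase := by
  simp [erase, map_map]

lemma edges_map {X : Type u} {I : Type v} {J : Type w} (f : I → J) (α : Formula (X × I)) :
    (α.map (Prod.map id f)).edges = α.edges.map f := by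
  simp [edges, leaves_map]

end Formula

/-! ### The structural rule instances of a decorated chain -/

variable {X : Type u} [DualAtoms X] {F : FlowGraph.{w}} {G : FlowGraph.{w'}}

/-- A decorated structural rule instance, bundled with its premiss and its conclusion. -/
structure RuleInstance (X : Type u) [DualAtoms X] (F : FlowGraph.{w}) where
  premiss : Formula (X × F.E)
  conclusion : Formula (X × F.E)
  rule : LabelledRule F premiss conclusion

/-- The vertex of a rule instance. -/
def RuleInstance.vertex (r : RuleInstance X F) : F.V := r.rule.vertex

/-- An edge of a conclusion of a rule instance is a lower edge of its vertex. -/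
lemma RuleInstance.up_eq (r : RuleInstance X F) {x : X × F.E}
    (hx : x ∈ r.conclusion.leaves) : F.up x.2 = some r.vertex := by
  obtain ⟨γ, δ, r⟩ := r
  rcases r <;> simp only [leaves, List.mem_append, List.mem_singleton, List.not_mem_nil] at hx <;>
    simp only [RuleInstance.vertex, LabelledRule.vertex]
  all_goals rcases hx with rfl | rfl <;> assumption

/-- The structural rule instance of a decorated step, if there is one. -/
def Step.rules {α β : Formula (X × F.E)} :
    Step (LabelledRule F) α β → List (RuleInstance X F)
  | linear _ => []
  | structural r => [⟨_, _, r⟩]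
  | orLeft s _ => s.rules
  | orRight _ s => s.rules
  | andLeft s _ => s.rules
  | andRight _ s => s.rules

/-- The structural rule instances of a decorated chain. -/
def Chain.rules {α β : Formula (X × F.E)} :
    Chain (LabelledRule F) α β → List (RuleInstance X F)
  | nil _ => []
  | cons s c => s.rules ++ c.rules

lemma Step.map_vertex_rules {α β : Formula (X × F.E)} (s : Step (LabelledRule F) α β) :
    s.rules.map RuleInstance.vertex = s.vertices := by
  induction s <;> simp_all [rules, vertices, RuleInstance.vertex]

/-- The list `rules` remembers premisses and conclusions, which `vertices` forgets. Through this
identity, absence of repetitions in `vertices` means that a vertex determines its rule instance. -/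
lemma Chain.map_vertex_rules {α β : Formula (X × F.E)} (c : Chain (LabelledRule F) α β) :
    c.rules.map RuleInstance.vertex = c.vertices := by
  induction c <;> simp_all [rules, vertices, Step.map_vertex_rules]

lemma Step.rules_eq_singleton {α β : Formula (X × F.E)} (s : Step (LabelledRule F) α β)
    {r : RuleInstance X F} (h : r ∈ s.rules) : s.rules = [r] := by
  induction s <;> simp_all [rules]

/-- Split a chain at one of its structural steps. -/
lemma Chain.exists_split {α β : Formula (X × F.E)} (c : Chain (LabelledRule F) α β)
    {r : RuleInstance X F} (h : r ∈ c.rules) :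
    ∃ (γ δ : Formula (X × F.E)) (c₁ : Chain (LabelledRule F) α γ) (s : Step (LabelledRule F) γ δ)
      (c₂ : Chain (LabelledRule F) δ β),
      s.rules = [r] ∧ c.rules = c₁.rules ++ r :: c₂.rules := by
  induction c with
  | nil => simp [rules] at h
  | cons s c ih =>
    rw [rules, List.mem_append] at h
    rcases h with h | h
    · exact ⟨_, _, .nil _, s, c, s.rules_eq_singleton h, by
        simp [rules, s.rules_eq_singleton h]⟩
    · obtain ⟨γ, δ, c₁, s', c₂, h₁, h₂⟩ := ih h
      exact ⟨γ, δ, .cons s c₁, s', c₂, h₁, by simp [rules, h₂]⟩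

/-- Linear rules only permute leaves and add or remove units. -/
lemma LinearRule.mem_leaves_iff {L : Type u} {α β : Formula L} (r : LinearRule α β) (x : L) :
    x ∈ β.leaves ↔ x ∈ α.leaves := by
  rcases r with _ | _ | e | e
  · simp [leaves]
  · simp only [leaves, List.mem_append]; tauto
  all_goals rcases e <;> simp [leaves, or_comm]

/-- A property of leaves that is preserved by the rules of a step is preserved by the step, and
holds in the premiss of the rule instance. -/
lemma Step.forall_leaves {α β : Formula (X × F.E)} (s : Step (LabelledRule F) α β)
    (P : X × F.E → Prop)
    (hP : ∀ r ∈ s.rules, (∀ x ∈ r.premiss.leaves, P x) → ∀ x ∈ r.conclusion.leaves, P x)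
    (hα : ∀ x ∈ α.leaves, P x) :
    (∀ x ∈ β.leaves, P x) ∧ ∀ r ∈ s.rules, ∀ x ∈ r.premiss.leaves, P x := by
  induction s with
  | linear r => exact ⟨fun x hx => hα x ((r.mem_leaves_iff x).1 hx), by simp [rules]⟩
  | structural r =>
    simp only [rules, List.mem_singleton, forall_eq] at hP ⊢
    exact ⟨hP hα, hα⟩
  -- The four context constructors are alike: the leaves of the context are untouched and the
  -- induction hypothesis handles the rest.
  | _ =>
    rename_i ih
    simp only [leaves, List.mem_append, or_imp, forall_and] at hα ⊢
    have := ih hP (by tauto)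
    exact ⟨by tauto, this.2⟩

/-- A property of leaves that holds in the premiss of a chain and is preserved by the structural
rule instances holds in the premiss of each of them. -/
lemma Chain.forall_leaves {α β : Formula (X × F.E)} (c : Chain (LabelledRule F) α β)
    (P : X × F.E → Prop)
    (hP : ∀ r ∈ c.rules, (∀ x ∈ r.premiss.leaves, P x) → ∀ x ∈ r.conclusion.leaves, P x)
    (hα : ∀ x ∈ α.leaves, P x) :
    ∀ r ∈ c.rules, ∀ x ∈ r.premiss.leaves, P x := by
  induction c with
  | nil => simp [rules]
  | cons s c ih =>
    simp only [rules, List.mem_append, or_imp, forall_and] at hP ⊢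
    have := s.forall_leaves P hP.1 hα
    exact ⟨this.2, ih hP.2 this.1⟩

/-! ### Derivability with a given multiset of vertices -/

/-- There is a decorated chain from `α` to `β` whose structural steps have the vertices `s`. -/
def Derives (F : FlowGraph.{w}) (α β : Formula (X × F.E)) (s : Multiset F.V) : Prop :=
  ∃ c : Chain (LabelledRule F) α β, (c.vertices : Multiset F.V) = s

/-- Concatenation of chains. -/
def Chain.append {L : Type u} {S : Formula L → Formula L → Type v} {α β γ : Formula L} :
    Chain S α β → Chain S β γ → Chain S α γ
  | nil _, c' => c'
  | cons s c, c' => cons s (c.append c')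

lemma Chain.vertices_append {α β γ : Formula (X × F.E)} (c : Chain (LabelledRule F) α β)
    (c' : Chain (LabelledRule F) β γ) : (c.append c').vertices = c.vertices ++ c'.vertices := by
  induction c <;> simp_all [append, vertices]

namespace Derives

variable {α β γ δ : Formula (X × F.E)} {s t : Multiset F.V}

lemma refl (α : Formula (X × F.E)) : Derives F α α 0 := ⟨.nil α, rfl⟩

lemma trans (h : Derives F α β s) (h' : Derives F β γ t) : Derives F α γ (s + t) := by
  obtain ⟨c, rfl⟩ := h
  obtain ⟨c', rfl⟩ := h'
  exact ⟨c.append c', by rw [Chain.vertices_append, Multiset.coe_add]⟩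

lemma trans_zero (h : Derives F α β s) (h' : Derives F β γ 0) : Derives F α γ s := by
  simpa using h.trans h'

lemma zero_trans (h : Derives F α β 0) (h' : Derives F β γ s) : Derives F α γ s := by
  simpa using h.trans h'

lemma of_step (r : Step (LabelledRule F) α β) : Derives F α β r.vertices :=
  ⟨.cons r (.nil _), by simp [Chain.vertices]⟩

lemma of_rule (r : LabelledRule F α β) : Derives F α β {r.vertex} :=
  of_step (.structural r)

lemma of_linear (r : LinearRule α β) : Derives F α β 0 := of_step (.linear r)

lemma of_eq (e : Equation α β) : Derives F α β 0 := of_linear (.eqLR e)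

lemma of_eq_symm (e : Equation α β) : Derives F β α 0 := of_linear (.eqRL e)

/-- Here `g` stands for one layer of context; `hg` lifts single steps without changing their
vertices, and induction on the chain does the rest. -/
lemma in_context (g : Formula (X × F.E) → Formula (X × F.E))
    (hg : ∀ {α β} (r : Step (LabelledRule F) α β),
      ∃ r' : Step (LabelledRule F) (g α) (g β), r'.vertices = r.vertices)
    (h : Derives F α β s) : Derives F (g α) (g β) s := by
  obtain ⟨c, rfl⟩ := h
  induction c with
  | nil => exact refl _
  | cons r c ih =>
    obtain ⟨r', hr'⟩ := hg r
    have := (of_step r').trans ih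
    rwa [hr', Multiset.coe_add] at this

lemma orLeft (h : Derives F α β s) (γ) : Derives F (or α γ) (or β γ) s :=
  h.in_context (fun α => or α γ) fun r => ⟨r.orLeft γ, rfl⟩

lemma orRight (γ) (h : Derives F α β s) : Derives F (or γ α) (or γ β) s :=
  h.in_context (or γ) fun r => ⟨r.orRight γ, rfl⟩

lemma andLeft (h : Derives F α β s) (γ) : Derives F (and α γ) (and β γ) s :=
  h.in_context (fun α => and α γ) fun r => ⟨r.andLeft γ, rfl⟩

lemma andRight (γ) (h : Derives F α β s) : Derives F (and γ α) (and γ β) s :=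
  h.in_context (and γ) fun r => ⟨r.andRight γ, rfl⟩

lemma orMap (h : Derives F α β s) (h' : Derives F γ δ t) :
    Derives F (or α γ) (or β δ) (s + t) :=
  (h.orLeft γ).trans (h'.orRight β)

lemma andMap (h : Derives F α β s) (h' : Derives F γ δ t) :
    Derives F (and α γ) (and β δ) (s + t) :=
  (h.andLeft γ).trans (h'.andRight β)

lemma orComm (α β : Formula (X × F.E)) : Derives F (or α β) (or β α) 0 := of_eq (.orComm α β)

lemma andComm (α β : Formula (X × F.E)) : Derives F (and α β) (and β α) 0 :=
  of_eq (.andComm α β)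

lemma switch (α β γ : Formula (X × F.E)) :
    Derives F (and α (or β γ)) (or (and α β) γ) 0 := of_linear (.switch α β γ)

lemma medial (α β γ δ : Formula (X × F.E)) :
    Derives F (or (and α β) (and γ δ)) (and (or α γ) (or β δ)) 0 :=
  of_linear (.medial α β γ δ)

/-- This regroups the copies of two conjuncts in the generic cocontraction; `or_or_or_comm` plays
the same role for disjuncts in the generic contraction. -/
lemma and_and_and_comm (α β γ δ : Formula (X × F.E)) :
    Derives F (and (and α β) (and γ δ)) (and (and α γ) (and β δ)) 0 :=
  (of_eq (.andAssoc _ _ _)).zero_trans <|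
    (((of_eq_symm (.andAssoc _ _ _)).zero_trans <|
      ((andComm _ _).andLeft _).zero_trans <| of_eq (.andAssoc _ _ _)).andRight α).zero_trans <|
    of_eq_symm (.andAssoc _ _ _)

lemma or_or_or_comm (α β γ δ : Formula (X × F.E)) :
    Derives F (or (or α β) (or γ δ)) (or (or α γ) (or β δ)) 0 :=
  (of_eq (.orAssoc _ _ _)).zero_trans <|
    (((of_eq_symm (.orAssoc _ _ _)).zero_trans <|
      ((orComm _ _).orLeft _).zero_trans <| of_eq (.orAssoc _ _ _)).orRight α).zero_trans <|
    of_eq_symm (.orAssoc _ _ _)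

/-- Generic cocontraction. -/
lemma cocontraction {I : Type v} (e₁ e₂ e₃ : I → F.E) (ν : I → F.V)
    (hν : ∀ i, F.η (ν i) = .cocontraction) (hne : ∀ i, e₂ i ≠ e₃ i)
    (h₁ : ∀ i, F.lo (e₁ i) = some (ν i)) (h₂ : ∀ i, F.up (e₂ i) = some (ν i))
    (h₃ : ∀ i, F.up (e₃ i) = some (ν i)) (α : Formula (X × I)) :
    Derives F (α.map (Prod.map id e₁))
      (and (α.map (Prod.map id e₂)) (α.map (Prod.map id e₃))) (α.edges.map ν) := by
  induction α with
  -- Duplicating a unit costs no structural step: `ff = (ff ∧ ff)` is an equation of its own, and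
  -- `tt = (tt ∧ tt)` is an instance of the unit law of conjunction.
  | ff => exact of_eq_symm .falseFalse
  | tt => exact of_eq_symm (.andTrue _)
  | leaf x =>
    exact of_rule (.cocontraction (ν x.2) x.1 (e₁ x.2) (e₂ x.2) (e₃ x.2) (hν _) (hne _) (h₁ _)
      (h₂ _) (h₃ _))
  | or α β ihα ihβ =>
    -- Medial turns the disjunction of two duplicated formulae into a duplicated disjunction.
    have := (ihα.orMap ihβ).trans_zero (medial _ _ _ _)
    simpa [edges, leaves, Formula.map] using this
  | and α β ihα ihβ =>
    have := (ihα.andMap ihβ).trans_zero (and_and_and_comm _ _ _ _)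
    simpa [edges, leaves, Formula.map] using this

/-- Generic contraction. -/
lemma contraction {I : Type v} (e₁ e₂ e₃ : I → F.E) (ν : I → F.V)
    (hν : ∀ i, F.η (ν i) = .contraction) (hne : ∀ i, e₁ i ≠ e₂ i)
    (h₁ : ∀ i, F.lo (e₁ i) = some (ν i)) (h₂ : ∀ i, F.lo (e₂ i) = some (ν i))
    (h₃ : ∀ i, F.up (e₃ i) = some (ν i)) (α : Formula (X × I)) :
    Derives F (or (α.map (Prod.map id e₁)) (α.map (Prod.map id e₂)))
      (α.map (Prod.map id e₃)) (α.edges.map ν) := by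
  induction α with
  | ff => exact of_eq (.orFalse _)
  | tt => exact of_eq .trueTrue
  | leaf x =>
    exact of_rule (.contraction (ν x.2) x.1 (e₁ x.2) (e₂ x.2) (e₃ x.2) (hν _) (hne _) (h₁ _)
      (h₂ _) (h₃ _))
  | or α β ihα ihβ =>
    have := (or_or_or_comm _ _ _ _).zero_trans (ihα.orMap ihβ)
    simpa [edges, leaves, Formula.map] using this
  | and α β ihα ihβ =>
    -- Medial pairs the corresponding conjuncts of the two copies before each pair is contracted.
    have := (medial _ _ _ _).zero_trans (ihα.andMap ihβ)
    simpa [edges, leaves, Formula.map] using this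

end Derives

/-! ### Substitution in chains -/

section Substitution

variable {α β : Formula (X × F.E)} (σ : X × F.E → Formula (X × G.E)) (t : F.V → Multiset G.V)

/-- The linear rules are schematic in arbitrary formulae and mention no atom, so they are closed
under substitution and use no vertex. -/
lemma LinearRule.derives_bind (r : LinearRule α β) : Derives G (α.bind σ) (β.bind σ) 0 := by
  rcases r with _ | _ | e | e
  · exact .switch _ _ _
  · exact .medial _ _ _ _
  · rcases e with _ | _ | _ | _ | _ | _ | _ | _
    · exact .of_eq (.orComm _ _)
    · exact .of_eq (.andComm _ _)
    · exact .of_eq (.orAssoc _ _ _)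
    · exact .of_eq (.andAssoc _ _ _)
    · exact .of_eq (.orFalse _)
    · exact .of_eq (.andTrue _)
    · exact .of_eq .trueTrue
    · exact .of_eq .falseFalse
  · rcases e with _ | _ | _ | _ | _ | _ | _ | _
    · exact .of_eq_symm (.orComm _ _)
    · exact .of_eq_symm (.andComm _ _)
    · exact .of_eq_symm (.orAssoc _ _ _)
    · exact .of_eq_symm (.andAssoc _ _ _)
    · exact .of_eq_symm (.orFalse _)
    · exact .of_eq_symm (.andTrue _)
    · exact .of_eq_symm .trueTrue
    · exact .of_eq_symm .falseFalse

/-- Structural rules mention atoms and need not survive substitution, so derivations of their images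
are assumed; `t` records the vertices that these derivations use. -/
lemma Step.derives_bind (s : Step (LabelledRule F) α β)
    (h : ∀ r ∈ s.rules, Derives G (r.premiss.bind σ) (r.conclusion.bind σ) (t r.vertex)) :
    Derives G (α.bind σ) (β.bind σ) ((s.vertices : Multiset F.V).bind t) := by
  induction s with
  | linear r => exact r.derives_bind σ
  | structural r => simpa [vertices, RuleInstance.vertex] using h _ (List.mem_singleton.2 rfl)
  | orLeft s γ ih => exact (ih h).orLeft _
  | orRight γ s ih => exact (ih h).orRight _
  | andLeft s γ ih => exact (ih h).andLeft _
  | andRight γ s ih => exact (ih h).andRight _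

/-- Substitution in a chain, given the images of its structural rule instances. -/
lemma Chain.derives_bind (c : Chain (LabelledRule F) α β)
    (h : ∀ r ∈ c.rules, Derives G (r.premiss.bind σ) (r.conclusion.bind σ) (t r.vertex)) :
    Derives G (α.bind σ) (β.bind σ) ((c.vertices : Multiset F.V).bind t) := by
  induction c with
  | nil => exact .refl _
  | cons s c ih =>
    simp only [rules, List.mem_append, or_imp, forall_and] at h
    have := (s.derives_bind σ t h.1).trans (ih h.2)
    rwa [← Multiset.add_bind, Multiset.coe_add] at this

/-- If the image of a rule instance consumes an additional conjunct, then so does the image of the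
step. -/
lemma Step.derives_bind_and (κ : Formula (X × G.E)) (s : Step (LabelledRule F) α β)
    {r : RuleInstance X F} (hs : s.rules = [r])
    (h : Derives G (and κ (r.premiss.bind σ)) (r.conclusion.bind σ) (t r.vertex)) :
    Derives G (and κ (α.bind σ)) (β.bind σ) (t r.vertex) := by
  induction s with
  | linear r => simp [rules] at hs
  | structural r' =>
    simp only [rules, List.cons.injEq, and_true] at hs
    subst hs
    exact h
  -- The conjunct `κ` travels inwards to the rule instance, by switch through a disjunction and by
  -- associativity through a conjunction. Commutativity is needed first when the active formula is
  -- on the right.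
  | orLeft s γ ih => exact (Derives.switch _ _ _).zero_trans ((ih hs).orLeft _)
  | orRight γ s ih =>
    exact (((Derives.orComm _ _).andRight _).zero_trans (.switch _ _ _)).zero_trans <|
      ((ih hs).orLeft _).trans_zero (.orComm _ _)
  | andLeft s γ ih => exact (Derives.of_eq_symm (.andAssoc _ _ _)).zero_trans ((ih hs).andLeft _)
  | andRight γ s ih =>
    exact (((Derives.andComm _ _).andRight _).zero_trans
      (.of_eq_symm (.andAssoc _ _ _))).zero_trans <|
      ((ih hs).andLeft _).trans_zero (.andComm _ _)

/-- If the image of a rule instance produces an additional disjunct, then so does the image of the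
step. -/
lemma Step.derives_bind_or (κ : Formula (X × G.E)) (s : Step (LabelledRule F) α β)
    {r : RuleInstance X F} (hs : s.rules = [r])
    (h : Derives G (r.premiss.bind σ) (or (r.conclusion.bind σ) κ) (t r.vertex)) :
    Derives G (α.bind σ) (or (β.bind σ) κ) (t r.vertex) := by
  induction s with
  | linear r => simp [rules] at hs
  | structural r' =>
    simp only [rules, List.cons.injEq, and_true] at hs
    subst hs
    exact h
  -- The disjunct `κ` travels outwards from the rule instance, by associativity through a
  -- disjunction and by switch through a conjunction.
  | orLeft s γ ih =>
    exact ((Derives.orComm _ _).zero_trans ((ih hs).orRight _)).trans_zero <|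
      (Derives.of_eq_symm (.orAssoc _ _ _)).zero_trans ((Derives.orComm _ _).orLeft _)
  | orRight γ s ih =>
    exact ((ih hs).orRight _).trans_zero (.of_eq_symm (.orAssoc _ _ _))
  | andLeft s γ ih =>
    exact ((Derives.andComm _ _).zero_trans ((ih hs).andRight _)).trans_zero <|
      (Derives.switch _ _ _).zero_trans ((Derives.andComm _ _).orLeft _)
  | andRight γ s ih => exact ((ih hs).andRight _).trans_zero (.switch _ _ _)

/-- Split a chain at the only structural step with a given vertex. -/
lemma Chain.exists_split_of_nodup (c : Chain (LabelledRule F) α β) (hc : c.vertices.Nodup)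
    {r₀ : RuleInstance X F} (hr₀ : r₀ ∈ c.rules) :
    ∃ (γ δ : Formula (X × F.E)) (c₁ : Chain (LabelledRule F) α γ) (s : Step (LabelledRule F) γ δ)
      (c₂ : Chain (LabelledRule F) δ β), s.rules = [r₀] ∧
      (c.vertices : Multiset F.V) = c₁.vertices + ({r₀.vertex} + c₂.vertices) ∧
      (∀ r ∈ c₁.rules, r ∈ c.rules ∧ r.vertex ≠ r₀.vertex) ∧
      (∀ r ∈ c₂.rules, r ∈ c.rules ∧ r.vertex ≠ r₀.vertex) := by
  obtain ⟨γ, δ, c₁, s, c₂, hs, h⟩ := c.exists_split hr₀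
  have hv : c.vertices = c₁.vertices ++ r₀.vertex :: c₂.vertices := by
    simp only [← map_vertex_rules, h, List.map_append, List.map_cons]
  -- Absence of repetitions puts the vertex of `r₀` outside both remaining segments, so no instance
  -- there shares it.
  rw [hv, List.nodup_middle, List.nodup_cons, List.mem_append, not_or] at hc
  refine ⟨γ, δ, c₁, s, c₂, hs, by rw [hv]; rfl, fun r hr => ⟨by simp [h, hr], ?_⟩,
    fun r hr => ⟨by simp [h, hr], ?_⟩⟩
  · intro e
    rw [← e, ← c₁.map_vertex_rules] at hc
    exact hc.1.1 (List.mem_map_of_mem hr)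
  · intro e
    rw [← e, ← c₂.map_vertex_rules] at hc
    exact hc.1.2 (List.mem_map_of_mem hr)

/-- If the image of one rule instance of a chain consumes an additional conjunct, then so does the
image of the chain. -/
lemma Chain.derives_bind_and (κ : Formula (X × G.E)) (c : Chain (LabelledRule F) α β)
    (hc : c.vertices.Nodup) {r₀ : RuleInstance X F} (hr₀ : r₀ ∈ c.rules)
    (h₀ : Derives G (and κ (r₀.premiss.bind σ)) (r₀.conclusion.bind σ) (t r₀.vertex))
    (h : ∀ r ∈ c.rules, r.vertex ≠ r₀.vertex →
      Derives G (r.premiss.bind σ) (r.conclusion.bind σ) (t r.vertex)) :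
    Derives G (and κ (α.bind σ)) (β.bind σ) ((c.vertices : Multiset F.V).bind t) := by
  obtain ⟨γ, δ, c₁, s, c₂, hs, hv, h₁, h₂⟩ := c.exists_split_of_nodup hc hr₀
  rw [hv, Multiset.add_bind, Multiset.add_bind, Multiset.singleton_bind]
  -- The conjunct `κ` is carried unused beside the image of `c₁`, absorbed at `s`, and absent from
  -- the image of `c₂`.
  exact ((c₁.derives_bind σ t fun r hr => h r (h₁ r hr).1 (h₁ r hr).2).andRight κ).trans <|
    (s.derives_bind_and σ t κ hs h₀).trans <|
    c₂.derives_bind σ t fun r hr => h r (h₂ r hr).1 (h₂ r hr).2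

/-- If the image of one rule instance of a chain produces an additional disjunct, then so does the
image of the chain. -/
lemma Chain.derives_bind_or (κ : Formula (X × G.E)) (c : Chain (LabelledRule F) α β)
    (hc : c.vertices.Nodup) {r₀ : RuleInstance X F} (hr₀ : r₀ ∈ c.rules)
    (h₀ : Derives G (r₀.premiss.bind σ) (or (r₀.conclusion.bind σ) κ) (t r₀.vertex))
    (h : ∀ r ∈ c.rules, r.vertex ≠ r₀.vertex →
      Derives G (r.premiss.bind σ) (r.conclusion.bind σ) (t r.vertex)) :
    Derives G (α.bind σ) (or (β.bind σ) κ) ((c.vertices : Multiset F.V).bind t) := by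
  obtain ⟨γ, δ, c₁, s, c₂, hs, hv, h₁, h₂⟩ := c.exists_split_of_nodup hc hr₀
  rw [hv, Multiset.add_bind, Multiset.add_bind, Multiset.singleton_bind]
  -- Dually, `κ` appears at `s` and is carried beside the image of `c₂`.
  exact (c₁.derives_bind σ t fun r hr => h r (h₁ r hr).1 (h₁ r hr).2).trans <|
    (s.derives_bind_or σ t κ hs h₀).trans <|
    (c₂.derives_bind σ t fun r hr => h r (h₂ r hr).1 (h₂ r hr).2).orLeft κ

/-- The image of a rule instance under a map that sends the edges of its vertex to those of a
vertex with the same label. -/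
lemma RuleInstance.derives_bind (r : RuleInstance X F) (g : F.E → G.E) (μ : G.V)
    (hη : G.η μ = F.η r.vertex)
    (hσ : ∀ e ∈ F.edgesOf r.vertex, ∀ x, σ (x, e) = leaf (x, g e))
    (hg : Set.InjOn g (F.edgesOf r.vertex))
    (hup : ∀ e, F.up e = some r.vertex → G.up (g e) = some μ)
    (hlo : ∀ e, F.lo e = some r.vertex → G.lo (g e) = some μ) :
    Derives G (r.premiss.bind σ) (r.conclusion.bind σ) {μ} := by
  have mem_up : ∀ {e}, F.up e = some r.vertex → e ∈ F.edgesOf r.vertex := fun h => .inl h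
  have mem_lo : ∀ {e}, F.lo e = some r.vertex → e ∈ F.edgesOf r.vertex := fun h => .inr h
  obtain ⟨γ, δ, r⟩ := r
  rcases r with ⟨ν, a, e₁, e₂, hν, hne, h₁, h₂⟩ | ⟨ν, a, e₁, e₂, hν, hne, h₁, h₂⟩ |
    ⟨ν, a, e₁, hν, h₁⟩ | ⟨ν, a, e₁, hν, h₁⟩ | ⟨ν, a, e₁, e₂, e₃, hν, hne, h₁, h₂, h₃⟩ |
    ⟨ν, a, e₁, e₂, e₃, hν, hne, h₁, h₂, h₃⟩ <;>
    simp only [RuleInstance.vertex, LabelledRule.vertex] at * <;>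
    simp only [Formula.bind]
  · rw [hσ _ (mem_up h₁), hσ _ (mem_up h₂)]
    exact .of_rule (.interaction μ a _ _ (hη.trans hν)
      -- Injectivity on the edges of the vertex keeps the two edges distinct, as a decorated
      -- instance requires.
      (fun h => hne (hg (mem_up h₁) (mem_up h₂) h)) (hup _ h₁) (hup _ h₂))
  · rw [hσ _ (mem_lo h₁), hσ _ (mem_lo h₂)]
    exact .of_rule (.cointeraction μ a _ _ (hη.trans hν)
      (fun h => hne (hg (mem_lo h₁) (mem_lo h₂) h)) (hlo _ h₁) (hlo _ h₂))
  · rw [hσ _ (mem_up h₁)]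
    exact .of_rule (.weakening μ a _ (hη.trans hν) (hup _ h₁))
  · rw [hσ _ (mem_lo h₁)]
    exact .of_rule (.coweakening μ a _ (hη.trans hν) (hlo _ h₁))
  · rw [hσ _ (mem_lo h₁), hσ _ (mem_lo h₂), hσ _ (mem_up h₃)]
    exact .of_rule (.contraction μ a _ _ _ (hη.trans hν)
      (fun h => hne (hg (mem_lo h₁) (mem_lo h₂) h)) (hlo _ h₁) (hlo _ h₂) (hup _ h₃))
  · rw [hσ _ (mem_lo h₁), hσ _ (mem_up h₂), hσ _ (mem_up h₃)]
    exact .of_rule (.cocontraction μ a _ _ _ (hη.trans hν)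
      (fun h => hne (hg (mem_up h₂) (mem_up h₃) h)) (hlo _ h₁) (hup _ h₂) (hup _ h₃))

end Substitution

/-! ### Transport along isomorphisms of flows -/

/-- Some derivation from `p` to `q` has the flow `F`. -/
def FlowBetween (F : FlowGraph.{w}) (p q : Formula X) : Prop :=
  ∃ (α β : Formula (X × F.E)) (s : Multiset F.V), Derives F α β s ∧ α.erase = p ∧ β.erase = q ∧
    (s.Nodup ∧ ∀ ν, ν ∈ s) ∧
    (α.edges.Nodup ∧ ∀ e, e ∈ α.edges ↔ e ∈ F.lowerEdges none) ∧
    (β.edges.Nodup ∧ ∀ e, e ∈ β.edges ↔ e ∈ F.upperEdges none)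

/-- The order of the structural steps is irrelevant to having a given flow, so a multiset of
vertices suffices. `FlowBetween` also makes sense for a bare flow graph, which frees the main
construction from `IsFlow`. -/
lemma Derivation.HasFlow.flowBetween {Φ : Derivation X} {A : AtomicFlow.{w}} (h : Φ.HasFlow A) :
    FlowBetween A.toFlowGraph Φ.premiss Φ.conclusion := by
  obtain ⟨α, β, c, rfl, hc, hα, hβ⟩ := h
  exact ⟨α, β, _, ⟨c, rfl⟩, rfl, rfl, by simpa using hc, hα, hβ⟩

lemma FlowBetween.exists_hasFlow {A : AtomicFlow.{w}} {p q : Formula X}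
    (h : FlowBetween A.toFlowGraph p q) :
    ∃ Ψ : Derivation X, Ψ.HasFlow A ∧ Ψ.premiss = p ∧ Ψ.conclusion = q := by
  obtain ⟨α, β, _, ⟨c, rfl⟩, rfl, rfl, hc, hα, hβ⟩ := h
  exact ⟨⟨_, _, c.erase⟩, ⟨α, β, c, rfl, by simpa using hc, hα, hβ⟩, rfl, rfl⟩

/-- The inverse of an isomorphism. -/
def FlowGraph.Iso.symm {F G : FlowGraph.{w}} (i : F.Iso G) : G.Iso F where
  onV := i.onV.symm
  onE := i.onE.symm
  map_η ν := by rw [← i.map_η, Equiv.apply_symm_apply]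
  map_up e := by
    obtain ⟨e, rfl⟩ := i.onE.surjective e
    rw [i.map_up]
    simp
  map_lo e := by
    obtain ⟨e, rfl⟩ := i.onE.surjective e
    rw [i.map_lo]
    simp

/-- An isomorphism acts as a substitution of leaves for leaves that renames edges and keeps atoms,
so the undecorated premiss and conclusion do not change. -/
lemma FlowBetween.of_iso {F G : FlowGraph.{w}} (i : F.Iso G) {p q : Formula X}
    (h : FlowBetween F p q) : FlowBetween G p q := by
  obtain ⟨α, β, s, ⟨c, rfl⟩, rfl, rfl, hc, hα, hβ⟩ := h
  have key := c.derives_bind (fun x => leaf (Prod.map id i.onE x)) (fun ν => {i.onV ν})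
    fun r _ => r.derives_bind _ i.onE (i.onV r.vertex) (i.map_η _) (fun _ _ _ => rfl)
      i.onE.injective.injOn (fun e he => by simp [i.map_up, he]) (fun e he => by simp [i.map_lo, he])
  rw [bind_leaf_comp, bind_leaf_comp, Multiset.bind_singleton] at key
  refine ⟨_, _, _, key, erase_map _ _, erase_map _ _,
    ⟨hc.1.map i.onV.injective, fun ν => ?_⟩, ⟨?_, fun e => ?_⟩, ⟨?_, fun e => ?_⟩⟩
  · exact Multiset.mem_map.2 ⟨i.onV.symm ν, hc.2 _, by simp⟩
  · rw [edges_map]; exact hα.1.map i.onE.injective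
  · obtain ⟨e, rfl⟩ := i.onE.surjective e
    simp [edges_map, hα.2, FlowGraph.lowerEdges, i.map_up]
  · rw [edges_map]; exact hβ.1.map i.onE.injective
  · obtain ⟨e, rfl⟩ := i.onE.surjective e
    simp [edges_map, hβ.2, FlowGraph.upperEdges, i.map_lo]

/-! ### Elimination of a simple edge -/

namespace SEData

variable (d : SEData.{w})

/-! ### Edges and rule instances at the vertices of the redex. -/

lemma redex_up_old {e : d.redex.E} {ν : d.A.V} (h : d.redex.up e = some (.old ν)) :
    ∃ e', e = .old e' ∧ d.A.up e' = some ν := by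
  rcases e with e | _
  · refine ⟨e, rfl, ?_⟩
    by_cases he : e = d.e₂ <;> simp_all
  · simp at h

lemma redex_lo_old {e : d.redex.E} {ν : d.A.V} (h : d.redex.lo e = some (.old ν)) :
    ∃ e', e = .old e' ∧ d.A.lo e' = some ν := by
  rcases e with e | _
  · refine ⟨e, rfl, ?_⟩
    by_cases he : e = d.e₃ <;> simp_all
  · simp at h

lemma redex_up_inter {e : d.redex.E} (h : d.redex.up e = some .inter) :
    e = .old d.e₂ ∨ e = .simple := by
  have : e ∈ d.redex.edgesOf .inter := .inl h
  simpa [edgesOf_redex_inter] using this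

lemma redex_lo_cointer {e : d.redex.E} (h : d.redex.lo e = some .cointer) :
    e = .old d.e₃ ∨ e = .simple := by
  have : e ∈ d.redex.edgesOf .cointer := .inr h
  simpa [edgesOf_redex_cointer] using this

/-- The interaction of the redex, with the atom `x` on the simple edge. -/
lemma rule_inter (r : RuleInstance X d.redex) (hr : r.vertex = .inter) :
    ∃ x : X, r.premiss = tt ∧
      (r.conclusion = or (leaf (x, .simple)) (leaf (dual x, .old d.e₂)) ∨
        r.conclusion = or (leaf (dual x, .old d.e₂)) (leaf (x, .simple))) := by
  obtain ⟨γ, δ, r⟩ := r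
  rcases r with ⟨ν, a, e₁, e₂, hν, hne, h₁, h₂⟩ | ⟨ν, a, e₁, e₂, hν, hne, h₁, h₂⟩ |
    ⟨ν, a, e₁, hν, h₁⟩ | ⟨ν, a, e₁, hν, h₁⟩ | ⟨ν, a, e₁, e₂, e₃, hν, hne, h₁, h₂, h₃⟩ |
    ⟨ν, a, e₁, e₂, e₃, hν, hne, h₁, h₂, h₃⟩ <;>
    simp only [RuleInstance.vertex, LabelledRule.vertex] at hr <;> subst hr <;> try cases hν
  rcases d.redex_up_inter h₁ with rfl | rfl <;> rcases d.redex_up_inter h₂ with rfl | rfl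
  · exact absurd rfl hne
  -- The simple edge decorates the second leaf here, whose atom is `dual a`; the other atom `a` is
  -- then the dual of `dual a`.
  · exact ⟨dual a, rfl, .inr (by simp only [dual_dual])⟩
  · exact ⟨a, rfl, .inl rfl⟩
  · exact absurd rfl hne

/-- The cointeraction of the redex, with the atom `x` on the simple edge. -/
lemma rule_cointer (r : RuleInstance X d.redex) (hr : r.vertex = .cointer) :
    ∃ x : X, r.conclusion = ff ∧
      (r.premiss = and (leaf (x, .simple)) (leaf (dual x, .old d.e₃)) ∨
        r.premiss = and (leaf (dual x, .old d.e₃)) (leaf (x, .simple))) := by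
  obtain ⟨γ, δ, r⟩ := r
  rcases r with ⟨ν, a, e₁, e₂, hν, hne, h₁, h₂⟩ | ⟨ν, a, e₁, e₂, hν, hne, h₁, h₂⟩ |
    ⟨ν, a, e₁, hν, h₁⟩ | ⟨ν, a, e₁, hν, h₁⟩ | ⟨ν, a, e₁, e₂, e₃, hν, hne, h₁, h₂, h₃⟩ |
    ⟨ν, a, e₁, e₂, e₃, hν, hne, h₁, h₂, h₃⟩ <;>
    simp only [RuleInstance.vertex, LabelledRule.vertex] at hr <;> subst hr <;> try cases hν
  rcases d.redex_lo_cointer h₁ with rfl | rfl <;> rcases d.redex_lo_cointer h₂ with rfl | rfl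
  · exact absurd rfl hne
  · exact ⟨dual a, rfl, .inr (by simp only [dual_dual])⟩
  · exact ⟨a, rfl, .inl rfl⟩
  · exact absurd rfl hne

/-- The substitution for the copy `hat`: the simple edge is replaced by false. -/
noncomputable def hatSubst (x : X × d.redex.E) : Formula (X × d.contractum.E) :=
  match x with
  | (a, .old e) => leaf (a, d.hatEdge e)
  | (_, .simple) => ff

/-- The substitution for the copy `tilde`: the simple edge is replaced by true. -/
def tildeSubst (x : X × d.redex.E) : Formula (X × d.contractum.E) :=
  match x with
  | (a, .old e) => leaf (a, d.tildeEdge e)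
  | (_, .simple) => tt

/-- The vertices of the copy `hat` that come from a vertex of the redex. -/
def hatVertices (ν : d.redex.V) : Multiset d.contractum.V :=
  match ν with
  | .old ν => {.hat ν}
  | .inter => 0
  | .cointer => {.coweak}

/-- The vertices of the copy `tilde` that come from a vertex of the redex. -/
def tildeVertices (ν : d.redex.V) : Multiset d.contractum.V :=
  match ν with
  | .old ν => {.tilde ν}
  | .inter => {.weak}
  | .cointer => 0

/-! ### Images of the structural rule instances in the two copies. -/

lemma derives_hat_old (r : RuleInstance X d.redex) {ν : d.A.V} (hr : r.vertex = .old ν) :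
    Derives d.contractum (r.premiss.bind d.hatSubst) (r.conclusion.bind d.hatSubst)
      (d.hatVertices r.vertex) := by
  have hE : d.redex.edgesOf r.vertex = RedexEdge.old '' d.A.edgesOf ν := by
    rw [hr, edgesOf_redex_old]
  -- The value of the renaming at the simple edge is a dummy: that edge does not belong to any old
  -- vertex.
  have key := r.derives_bind (G := d.contractum) d.hatSubst
    (fun e => match e with
      | .old e => d.hatEdge e
      | .simple => d.hatEdge d.e₂) (.hat ν) (by rw [hr]) ?_ ?_ ?_ ?_
  · rw [hr]; exact key
  · rw [hE]; rintro _ ⟨e, -, rfl⟩ x; rfl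
  · rw [hE]
    rintro _ ⟨e, -, rfl⟩ _ ⟨e', -, rfl⟩ h
    rw [d.hatEdge_injective h]
  · intro e he
    rw [hr] at he
    obtain ⟨e, rfl, he'⟩ := d.redex_up_old he
    exact (d.lower_hat ν).ge ⟨e, he', rfl⟩
  · intro e he
    rw [hr] at he
    obtain ⟨e, rfl, he'⟩ := d.redex_lo_old he
    exact (d.upper_hat ν).ge ⟨e, he', rfl⟩

lemma derives_tilde_old (r : RuleInstance X d.redex) {ν : d.A.V} (hr : r.vertex = .old ν) :
    Derives d.contractum (r.premiss.bind d.tildeSubst) (r.conclusion.bind d.tildeSubst)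
      (d.tildeVertices r.vertex) := by
  have hE : d.redex.edgesOf r.vertex = RedexEdge.old '' d.A.edgesOf ν := by
    rw [hr, edgesOf_redex_old]
  have key := r.derives_bind (G := d.contractum) d.tildeSubst
    (fun e => match e with
      | .old e => d.tildeEdge e
      | .simple => d.tildeEdge d.e₂) (.tilde ν) (by rw [hr]) ?_ ?_ ?_ ?_
  · rw [hr]; exact key
  · rw [hE]; rintro _ ⟨e, -, rfl⟩ x; rfl
  · rw [hE]
    rintro _ ⟨e, -, rfl⟩ _ ⟨e', -, rfl⟩ h
    rw [d.tildeEdge_injective h]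
  · intro e he
    rw [hr] at he
    obtain ⟨e, rfl, he'⟩ := d.redex_up_old he
    exact (d.lower_tilde ν).ge ⟨e, he', rfl⟩
  · intro e he
    rw [hr] at he
    obtain ⟨e, rfl, he'⟩ := d.redex_lo_old he
    exact (d.upper_tilde ν).ge ⟨e, he', rfl⟩

/-- With the simple edge at `ff`, the premiss of the cointeraction already contains the conclusion
`ff`; its partner only has to be discarded, by the new coweakening. -/
lemma derives_hat_cointer (r : RuleInstance X d.redex) (hr : r.vertex = .cointer) :
    Derives d.contractum (r.premiss.bind d.hatSubst) (r.conclusion.bind d.hatSubst)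
      (d.hatVertices r.vertex) := by
  obtain ⟨x, h, h'⟩ := d.rule_cointer r hr
  have he : d.contractum.lo (d.hatEdge d.e₃) = some .coweak := d.upper_coweak.ge rfl
  have coweak : Derives d.contractum (leaf (dual x, d.hatEdge d.e₃)) tt {.coweak} :=
    .of_rule
      (LabelledRule.coweakening (F := d.contractum) (CVertex.coweak : CVertex d)
        (dual x) (d.hatEdge d.e₃) rfl he)
  -- The derivation is `(ff ∧ x̄) → (ff ∧ tt) = ff`.
  have key := (coweak.andRight ff).trans_zero (.of_eq (.andTrue _))
  rw [h, hr]
  rcases h' with h' | h' <;> rw [h']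
  · exact key
  · exact (Derives.andComm _ _).zero_trans key

/-- With the simple edge at `tt`, the conclusion of the interaction is the premiss `tt` plus a
disjunct, which the new weakening supplies. -/
lemma derives_tilde_inter (r : RuleInstance X d.redex) (hr : r.vertex = .inter) :
    Derives d.contractum (r.premiss.bind d.tildeSubst) (r.conclusion.bind d.tildeSubst)
      (d.tildeVertices r.vertex) := by
  obtain ⟨x, h, h'⟩ := d.rule_inter r hr
  have he : d.contractum.up (d.tildeEdge d.e₂) = some .weak := d.lower_weak.ge rfl
  have weak : Derives d.contractum ff (leaf (dual x, d.tildeEdge d.e₂)) {.weak} :=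
    .of_rule
      (LabelledRule.weakening (F := d.contractum) (CVertex.weak : CVertex d)
        (dual x) (d.tildeEdge d.e₂) rfl he)
  have key := (Derives.of_eq_symm (.orFalse _)).zero_trans (weak.orRight tt)
  rw [h, hr]
  rcases h' with h' | h' <;> rw [h']
  · exact key
  · exact key.trans_zero (.orComm _ _)

/-- The simple edge carries a single atom `x`, so that its dual is the atom consumed at the
interaction in the copy `hat` and the atom produced at the cointeraction in the copy `tilde`. -/
lemma exists_simple_atom {α β : Formula (X × d.redex.E)}
    (c : Chain (LabelledRule d.redex) α β) (hc : c.vertices.Nodup)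
    (hα : ∀ x ∈ α.leaves, x.2 ≠ .simple) {r₂ r₃ : RuleInstance X d.redex} (h₂ : r₂ ∈ c.rules)
    (h₃ : r₃ ∈ c.rules) (hr₂ : r₂.vertex = .inter) (hr₃ : r₃.vertex = .cointer) :
    ∃ x : X,
      Derives d.contractum (and (leaf (dual x, d.hatEdge d.e₂)) (r₂.premiss.bind d.hatSubst))
        (r₂.conclusion.bind d.hatSubst) (d.hatVertices r₂.vertex) ∧
      Derives d.contractum (r₃.premiss.bind d.tildeSubst)
        (or (r₃.conclusion.bind d.tildeSubst) (leaf (dual x, d.tildeEdge d.e₃)))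
        (d.tildeVertices r₃.vertex) := by
  obtain ⟨x, h, h'⟩ := d.rule_inter r₂ hr₂
  obtain ⟨y, k, k'⟩ := d.rule_cointer r₃ hr₃
  have hxy : y = x := by
    -- The invariant along the chain is that every occurrence on the simple edge has the atom `x`;
    -- it holds vacuously in the premiss.
    have := c.forall_leaves (fun z => z.2 = .simple → z.1 = x) (fun r hr _ z hz hzs => ?_)
      (fun z hz hzs => absurd hzs (hα z hz)) r₃ h₃
    · rcases k' with k' | k' <;> exact this (y, .simple) (by simp [k', leaves]) rfl
    -- A rule instance that creates an occurrence on the simple edge sits at the interaction, where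
    -- that edge starts; vertices are not repeated, so it is `r₂`.
    · have hr' : r = r₂ := by
        rw [← c.map_vertex_rules] at hc
        refine List.inj_on_of_nodup_map hc hr h₂ ?_
        have := r.up_eq hz
        rw [hzs] at this
        rw [hr₂]
        exact (Option.some.inj this).symm
      subst hr'
      obtain ⟨z, e⟩ := z
      rcases h' with h' | h' <;> rw [h'] at hz <;> simp_all [leaves]
  subst hxy
  refine ⟨y, ?_, ?_⟩
  -- The supplied `x̄` replaces the one that the interaction would have created. Only unit laws are
  -- used, in accordance with the value `0` of `hatVertices` at the interaction.
  · have key : Derives d.contractum (and (leaf (dual y, d.hatEdge d.e₂)) tt)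
        (or (leaf (dual y, d.hatEdge d.e₂)) ff) 0 :=
      (Derives.of_eq (.andTrue _)).zero_trans (.of_eq_symm (.orFalse _))
    rw [h, hr₂]
    rcases h' with h' | h' <;> rw [h']
    · exact key.trans_zero (.orComm _ _)
    · exact key
  -- Dually, the occurrence that the cointeraction would have destroyed is passed on as a disjunct,
  -- at no structural cost.
  · have key : Derives d.contractum (and (leaf (dual y, d.tildeEdge d.e₃)) tt)
        (or ff (leaf (dual y, d.tildeEdge d.e₃))) 0 :=
      ((Derives.of_eq (.andTrue _)).zero_trans (.of_eq_symm (.orFalse _))).zero_trans (.orComm _ _)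
    rw [k, hr₃]
    rcases k' with k' | k' <;> rw [k']
    · exact (Derives.andComm _ _).zero_trans key
    · exact key

/-! ### Premiss and conclusion: new cocontractions and contractions. -/

/-- In the redex both `e₂` and the simple edge start at the interaction, so the upper edges are
exactly those in `Upper d`. Indexing the premiss by that type gives one cocontraction vertex per
atom occurrence. -/
lemma exists_map_upper {Y : Type u} {α : Formula (Y × d.redex.E)} (h : α.edges.Nodup)
    (h' : ∀ e, e ∈ α.edges ↔ e ∈ d.redex.lowerEdges none) :
    ∃ α₀ : Formula (Y × Upper d), α₀.map (Prod.map id fun e => .old e.1) = α ∧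
      α₀.edges.Nodup ∧ ∀ e, e ∈ α₀.edges := by
  have hup : ∀ e, d.redex.up e = none ↔ ∃ u : Upper d, e = .old u.1 := by
    rintro (e | _)
    · by_cases he : e = d.e₂ <;> simp [he]
    · simp
  obtain ⟨α₀, rfl⟩ := exists_map_eq (Prod.map id fun e : Upper d => RedexEdge.old e.1) α
    fun x hx => by
      obtain ⟨u, hu⟩ := (hup x.2).1 ((h' x.2).1 (List.mem_map_of_mem hx))
      exact ⟨(x.1, u), by rw [Prod.map_apply, ← hu]; rfl⟩
  rw [edges_map] at h h'
  refine ⟨α₀, rfl, h.of_map _, fun e => ?_⟩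
  obtain ⟨e', he', h⟩ := List.mem_map.1 ((h' (.old e.1)).2 ((hup _).2 ⟨e, rfl⟩))
  obtain rfl : e' = e := Subtype.ext (by simpa using h)
  exact he'

/-- The mirror image of `exists_map_upper`: `e₃` and the simple edge end at the cointeraction. -/
lemma exists_map_lower {Y : Type u} {β : Formula (Y × d.redex.E)} (h : β.edges.Nodup)
    (h' : ∀ e, e ∈ β.edges ↔ e ∈ d.redex.upperEdges none) :
    ∃ β₀ : Formula (Y × Lower d), β₀.map (Prod.map id fun e => .old e.1) = β ∧
      β₀.edges.Nodup ∧ ∀ e, e ∈ β₀.edges := by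
  have hlo : ∀ e, d.redex.lo e = none ↔ ∃ u : Lower d, e = .old u.1 := by
    rintro (e | _)
    · by_cases he : e = d.e₃ <;> simp [he]
    · simp
  obtain ⟨β₀, rfl⟩ := exists_map_eq (Prod.map id fun e : Lower d => RedexEdge.old e.1) β
    fun x hx => by
      obtain ⟨u, hu⟩ := (hlo x.2).1 ((h' x.2).1 (List.mem_map_of_mem hx))
      exact ⟨(x.1, u), by rw [Prod.map_apply, ← hu]; rfl⟩
  rw [edges_map] at h h'
  refine ⟨β₀, rfl, h.of_map _, fun e => ?_⟩
  obtain ⟨e', he', h⟩ := List.mem_map.1 ((h' (.old e.1)).2 ((hlo _).2 ⟨e, rfl⟩))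
  obtain rfl : e' = e := Subtype.ext (by simpa using h)
  exact he'

lemma derives_cocontr (α₀ : Formula (X × Upper d)) :
    Derives d.contractum (α₀.map (Prod.map id .upper))
      (and (α₀.map (Prod.map id fun e => d.hatEdge e.1))
        (α₀.map (Prod.map id fun e => d.tildeEdge e.1))) (α₀.edges.map CVertex.cocontr) :=
  .cocontraction _ _ _ _ (fun _ => rfl) (fun e => d.hatEdge_ne_tildeEdge (.inl e.2.2))
    (fun _ => rfl) (fun e => (d.lower_cocontr e).ge (.inl rfl))
    (fun e => (d.lower_cocontr e).ge (.inr rfl)) α₀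

lemma derives_contr (β₀ : Formula (X × Lower d)) :
    Derives d.contractum (or (β₀.map (Prod.map id fun e => d.hatEdge e.1))
        (β₀.map (Prod.map id fun e => d.tildeEdge e.1)))
      (β₀.map (Prod.map id .lower)) (β₀.edges.map CVertex.contr) :=
  .contraction _ _ _ _ (fun _ => rfl) (fun e => d.hatEdge_ne_tildeEdge (.inr e.2.2))
    (fun e => (d.upper_contr e).ge (.inl rfl)) (fun e => (d.upper_contr e).ge (.inr rfl))
    (fun _ => rfl) β₀

/-- This identification of edges makes the disjunct emitted by `tilde` the very conjunct consumed by
`hat`. -/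
lemma hatEdge_e₂ : d.hatEdge d.e₂ = d.tildeEdge d.e₃ := by
  simp [hatEdge, tildeEdge]

/-! ### Counting the vertices, and the assembled derivation. -/

/-- Each vertex of the redex contributes at most one vertex to the copy, and distinct vertices have
disjoint contributions. -/
lemma nodup_bind_hatVertices {s : Multiset d.redex.V} (hs : s.Nodup) :
    (s.bind d.hatVertices).Nodup := by
  refine Multiset.nodup_bind.2 ⟨?_, hs.pairwise ?_⟩
  · rintro (ν | _ | _) - <;> simp [hatVertices]
  · rintro (ν | _ | _) - (μ | _ | _) - h <;>
      simp_all [Function.onFun, hatVertices, eq_comm]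

lemma nodup_bind_tildeVertices {s : Multiset d.redex.V} (hs : s.Nodup) :
    (s.bind d.tildeVertices).Nodup := by
  refine Multiset.nodup_bind.2 ⟨?_, hs.pairwise ?_⟩
  · rintro (ν | _ | _) - <;> simp [tildeVertices]
  · rintro (ν | _ | _) - (μ | _ | _) - h <;>
      simp_all [Function.onFun, tildeVertices, eq_comm]

/-- The vertices of the contractum, sorted by their origin. -/
lemma nodup_contractum_vertices {s : Multiset d.redex.V} (hs : s.Nodup) (hs' : ∀ ν, ν ∈ s)
    {l : List (Upper d)} (hl : l.Nodup) (hl' : ∀ e, e ∈ l)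
    {m : List (Lower d)} (hm : m.Nodup) (hm' : ∀ e, e ∈ m) :
    let v : Multiset d.contractum.V := (l.map CVertex.cocontr : List d.contractum.V) +
      (s.bind d.tildeVertices + (s.bind d.hatVertices + (m.map CVertex.contr : List d.contractum.V)))
    v.Nodup ∧ ∀ ν, ν ∈ v := by
  have ht : ∀ ν, ν ∈ s.bind d.tildeVertices ↔ ν = .weak ∨ ∃ μ, ν = .tilde μ := by
    intro ν
    simp only [Multiset.mem_bind, hs', true_and]
    constructor
    · rintro ⟨_ | _ | _, h⟩ <;> simp [tildeVertices] at h <;> simp [h]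
    · rintro (rfl | ⟨μ, rfl⟩)
      · exact ⟨.inter, by simp [tildeVertices]⟩
      · exact ⟨.old μ, by simp [tildeVertices]⟩
  have hh : ∀ ν, ν ∈ s.bind d.hatVertices ↔ ν = .coweak ∨ ∃ μ, ν = .hat μ := by
    intro ν
    simp only [Multiset.mem_bind, hs', true_and]
    constructor
    · rintro ⟨_ | _ | _, h⟩ <;> simp [hatVertices] at h <;> simp [h]
    · rintro (rfl | ⟨μ, rfl⟩)
      · exact ⟨.cointer, by simp [hatVertices]⟩
      · exact ⟨.old μ, by simp [hatVertices]⟩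
  intro v
  constructor
  · simp only [v, Multiset.nodup_add, Multiset.coe_nodup, d.nodup_bind_hatVertices hs,
      d.nodup_bind_tildeVertices hs, Multiset.disjoint_left, Multiset.mem_add, Multiset.mem_coe,
      List.mem_map, ht, hh]
    refine ⟨hl.map fun e e' h => by injection h, ⟨trivial, ⟨trivial,
      hm.map fun e e' h => by injection h, ?_⟩, ?_⟩, ?_⟩
    · rintro ν (rfl | ⟨μ, rfl⟩) <;> simp
    · rintro ν (rfl | ⟨μ, rfl⟩) <;> simp
    · rintro ν ⟨e, -, rfl⟩; simp
  · rintro (ν | ν | _ | _ | e | e) <;> simp [v, ht, hh, hl', hm']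

/-- Every derivation with the redex as its flow gives one with the contractum as its flow. -/
theorem flowBetween_contractum {p q : Formula X} (h : FlowBetween d.redex p q) :
    FlowBetween d.contractum p q := by
  obtain ⟨α, β, s, ⟨c, rfl⟩, rfl, rfl, ⟨hs, hs'⟩, ⟨hα, hα'⟩, ⟨hβ, hβ'⟩⟩ := h
  obtain ⟨α₀, rfl, hα₀, hα₀'⟩ := d.exists_map_upper hα hα'
  obtain ⟨β₀, rfl, hβ₀, hβ₀'⟩ := d.exists_map_lower hβ hβ'
  have hc : c.vertices.Nodup := hs
  -- Every vertex of the redex is hit by the chain, so the interaction and the cointeraction have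
  -- rule instances in it.
  have exists_rule : ∀ ν, ∃ r ∈ c.rules, r.vertex = ν := fun ν => by
    have : ν ∈ c.vertices := hs' ν
    rwa [← c.map_vertex_rules, List.mem_map] at this
  obtain ⟨r₂, hr₂, hv₂⟩ := exists_rule .inter
  obtain ⟨r₃, hr₃, hv₃⟩ := exists_rule .cointer
  obtain ⟨x, h₂, h₃⟩ := d.exists_simple_atom c hc
    (by simp only [leaves_map, List.mem_map]; rintro _ ⟨y, -, rfl⟩; simp) hr₂ hr₃ hv₂ hv₃
  -- This is `(x̄ ∧ α̂) → β̂`; the exceptional instance is the interaction.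
  have hat := c.derives_bind_and d.hatSubst d.hatVertices _ hc hr₂ h₂ fun r _ hr => by
    rcases hv : r.vertex with ν | _ | _
    · rw [← hv]; exact d.derives_hat_old r hv
    · exact absurd (hv.trans hv₂.symm) hr
    · rw [← hv]; exact d.derives_hat_cointer r hv
  -- This is `α̃ → [β̃ ∨ x̄]`; the exceptional instance is the cointeraction.
  have tilde := c.derives_bind_or d.tildeSubst d.tildeVertices _ hc hr₃ h₃ fun r _ hr => by
    rcases hv : r.vertex with ν | _ | _
    · rw [← hv]; exact d.derives_tilde_old r hv
    · rw [← hv]; exact d.derives_tilde_inter r hv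
    · exact absurd (hv.trans hv₃.symm) hr
  -- The premiss and the conclusion avoid the simple edge, so on them both substitutions are mere
  -- renamings of edges.
  have hat_map : ∀ {I : Type w} (f : I → d.A.E) (γ : Formula (X × I)),
      (γ.map (Prod.map id fun i => RedexEdge.old (f i))).bind d.hatSubst =
        γ.map (Prod.map id fun i => d.hatEdge (f i)) := fun f γ => by
    rw [bind_map, ← bind_leaf_comp]; rfl
  have tilde_map : ∀ {I : Type w} (f : I → d.A.E) (γ : Formula (X × I)),
      (γ.map (Prod.map id fun i => RedexEdge.old (f i))).bind d.tildeSubst =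
        γ.map (Prod.map id fun i => d.tildeEdge (f i)) := fun f γ => by
    rw [bind_map, ← bind_leaf_comp]; rfl
  rw [hat_map, hat_map, hatEdge_e₂] at hat
  rw [tilde_map, tilde_map] at tilde
  refine ⟨α₀.map (Prod.map id .upper), β₀.map (Prod.map id .lower), _,
    (d.derives_cocontr α₀).trans <| ((tilde.andRight _).trans_zero ?_).trans <|
      (hat.orLeft _).trans (d.derives_contr β₀), by simp only [erase_map], by simp only [erase_map],
    d.nodup_contractum_vertices hs hs' hα₀ hα₀' hβ₀ hβ₀', ⟨?_, fun e => ?_⟩, ⟨?_, fun e => ?_⟩⟩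
  -- The junction of the copies is `(α̂ ∧ [β̃ ∨ x̄]) → (α̂ ∧ [x̄ ∨ β̃]) → [(α̂ ∧ x̄) ∨ β̃] → [(x̄ ∧
  -- α̂) ∨ β̃]`.
  · exact ((Derives.orComm _ _).andRight _).zero_trans <| (Derives.switch _ _ _).zero_trans <|
      (Derives.andComm _ _).orLeft _
  · rw [edges_map]; exact hα₀.map fun e e' h => by injection h
  · rcases e with e | e | e | e <;> simp [edges_map, FlowGraph.lowerEdges, hα₀']
  · rw [edges_map]; exact hβ₀.map fun e e' h => by injection h
  · rcases e with e | e | e | e <;> simp [edges_map, FlowGraph.upperEdges, hβ₀']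

end SEData

end AtomicFlows

theorem mainTheorem7 {X : Type*} [AtomicFlows.DualAtoms X] :
    AtomicFlows.Reduction.IsSound X AtomicFlows.se := by
  rintro B C ⟨d, h, ⟨i⟩, ⟨j⟩⟩ Φ hΦ
  -- The reduction is defined up to isomorphism, so the derivation is moved along `i` to the
  -- explicit redex, transformed, and moved back from the explicit contractum along the inverse of
  -- `j`.
  exact ((d.flowBetween_contractum (hΦ.flowBetween.of_iso i)).of_iso j.symm).exists_hasFlow
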